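/- All graphs are finite and simple, $\log$ is the natural logarithm, and "contains" means contains a copy as a (not necessarily induced) subgraph. A graph $H$ is $(n,e)$-unavoidable if every graph with $n$ vertices and $e$ edges contains $H$; for $0\le e\le\binom n2$ let $f(n,e)$ be the maximum number of edges of an $(n,e)$-unavoidable graph. For $0\le m\le\binom n2$ let $g(n,m)$ be the minimum number of edges of an $n$-vertex graph that contains every graph with $n$ vertices and $m$ edges. (a) There are absolute constants $c,C>0$ such that for all integers $n\ge 0$ and $e\ge 0$ for which $m=\binom n2-e$ satisfies $2\le m\le n\log n$, $$c\,\frac{m^2}{\log^2 m}\ \le\ \binom n2-f(n,e)\ \le\ C\,\frac{m^2}{\log^2 m}.$$ For every $\varepsilon>0$ there are constants $c,C>0$, depending only on $\varepsilon$, such that for all integers $n\ge 0$ and $e\ge 1$ for which $m=\binom n2-e$ satisfies $n\log n<m<n^{3/2-\varepsilon}$, $$c\,\frac{n^3\log n}{m}\ \le\ f(n,e)\ \le\ C\,\frac{n^3\log n}{m}.$$ (b) Equivalently, there are absolute constants $c,C>0$ such that for all integers $n,m$ with $2\le m\le\binom n2$ and $m\le n\log n$, $$c\,\frac{m^2}{\log^2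 m}\ \le\ g(n,m)\ \le\ C\,\frac{m^2}{\log^2 m},$$ and for every $\varepsilon>0$ there are constants $c,C>0$, depending only on $\varepsilon$, such that for all integers $n\ge 0$ and $m<\binom n2$ with $n\log n<m<n^{3/2-\varepsilon}$, $$c\,\frac{n^3\log n}{m}\ \le\ \binom n2-g(n,m)\ \le\ C\,\frac{n^3\log n}{m}.$$ (In the expressions above, $n\log n$ is read as $0$ for $n=0$.) -/

import Mathlib

open SimpleGraph

/-- The number of edges of a finite simple graph. -/
noncomputable def numEdges {V : Type*} (G : SimpleGraph V) : ℕ := G.edgeSet.ncard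

/-- A graph `H` is `(n, e)`-unavoidable if every graph on `n` vertices with `e` edges contains
a copy of `H` as a (not necessarily induced) subgraph. -/
def IsUnavoidable {W : Type*} (n e : ℕ) (H : SimpleGraph W) : Prop :=
  ∀ G : SimpleGraph (Fin n), numEdges G = e → H.IsContained G

/-- A graph `U` is `(n, m)`-universal if it contains a copy of every graph on `n` vertices
with `m` edges. -/
def IsUniversal {W : Type*} (n m : ℕ) (U : SimpleGraph W) : Prop :=
  ∀ H : SimpleGraph (Fin n), numEdges H = m → H.IsContained U

/-- The numbers of edges of `(n, e)`-unavoidable finite graphs (on any number of vertices). -/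
def unavoidableSizes (n e : ℕ) : Set ℕ :=
  {t | ∃ (k : ℕ) (H : SimpleGraph (Fin k)), IsUnavoidable n e H ∧ numEdges H = t}

/-- The numbers of edges of `(n, m)`-universal graphs on `n` vertices. -/
def universalSizes (n m : ℕ) : Set ℕ :=
  {t | ∃ U : SimpleGraph (Fin n), IsUniversal n m U ∧ numEdges U = t}

/-- `f(n, e)`: the maximum number of edges of an `(n, e)`-unavoidable graph. -/
noncomputable def unavoidMax (n e : ℕ) : ℕ := sSup (unavoidableSizes n e)

/-- `g(n, m)`: the minimum number of edges of an `(n, m)`-universal graph on `n` vertices. -/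
noncomputable def univMin (n m : ℕ) : ℕ := sInf (universalSizes n m)

theorem exists_numEdges_eq {n e : ℕ} (he : e ≤ n.choose 2) :
    ∃ G : SimpleGraph (Fin n), numEdges G = e := by
  classical
  have hc : (⊤ : SimpleGraph (Fin n)).edgeFinset.card = n.choose 2 := by
    simpa using card_edgeFinset_top_eq_card_choose_two (V := Fin n)
  obtain ⟨s, hs, hcard⟩ := Finset.exists_subset_card_eq (hc ▸ he)
  refine ⟨SimpleGraph.fromEdgeSet (s : Set (Sym2 (Fin n))), ?_⟩
  have h1 : (s : Set (Sym2 (Fin n))) \ {x | x.IsDiag} = s := by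
    ext x
    simp only [Set.mem_sdiff, Finset.mem_coe, Set.mem_ofPred_eq, and_iff_left_iff_imp]
    intro hx
    have := hs hx
    rw [mem_edgeFinset] at this
    exact not_isDiag_of_mem_edgeSet _ this
  unfold numEdges
  rw [edgeSet_fromEdgeSet]
  erw [h1]
  rw [Set.ncard_coe_finset, hcard]

/-- For `e ≤ C(n,2)` the supremum defining `unavoidMax` is a genuine maximum. -/
theorem unavoidMax_isGreatest {n e : ℕ} (he : e ≤ n.choose 2) :
    IsGreatest (unavoidableSizes n e) (unavoidMax n e) := by
  have hne : (unavoidableSizes n e).Nonempty :=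
    ⟨_, 0, ⊥, fun G _ => ⟨⟨⟨Fin.elim0, fun {a} => a.elim0⟩, fun a => a.elim0⟩⟩, rfl⟩
  have hb : BddAbove (unavoidableSizes n e) := by
    refine ⟨e, ?_⟩
    rintro t ⟨k, H, hH, rfl⟩
    obtain ⟨G, hG⟩ := exists_numEdges_eq he
    obtain ⟨φ⟩ := hH G hG
    rw [← hG]
    have hinj : Function.Injective φ.toHom.mapEdgeSet := Hom.mapEdgeSet.injective φ.toHom φ.injective
    have := Nat.card_le_card_of_injective _ hinj
    simpa only [numEdges, ← Nat.card_coe_set_eq] using this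
  exact ⟨Nat.sSup_mem hne hb, fun t ht => le_csSup hb ht⟩

/-- The infimum defining `univMin` is a genuine minimum. -/
theorem univMin_isLeast (n m : ℕ) : IsLeast (universalSizes n m) (univMin n m) :=
  ⟨Nat.sInf_mem ⟨_, ⊤, fun _ _ => IsContained.of_le le_top, rfl⟩, fun _ ht => Nat.sInf_le ht⟩

/-!
Complementing the unavoidable graph, padded to `n` vertices, gives
`univMin n m + unavoidMax n e = n.choose 2` for `e + m = n.choose 2`, so only universal graphs
need to be studied.

Lower bounds for universal graphs come from counting: if `U` is universal with `u` edges, then a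
graph with `n` vertices and `m` edges is determined by its image, one of at most `u.choose m` sets
of edges, and by the partial map from its vertices to the support of `U`.

Upper bounds come from colouring pairs of vertices uniformly at random: with positive probability
the colour classes (sparse range) or their complements (dense range) are expanding, in the sense
that among sufficiently many disjoint small sets there is one which is completely joined to some
vertex of any given large enough set. By pigeonhole some colour has few, respectively many, pairs.
A set of hubs is joined to everything; the vertices of the graph to be embedded are placed greedily,
and an independent set of low degree vertices, kept for the end, fills the places that are left. In
the sparse range the non-hubs are split into dyadic levels whose densities decrease geometrically,
the vertices of highest degree going to the hubs and to the densest levels.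
-/

theorem numEdges_eq_card {V : Type*} (G : SimpleGraph V) [Fintype G.edgeSet] :
    numEdges G = G.edgeFinset.card := by
  rw [numEdges, Set.ncard_eq_toFinset_card', edgeFinset]

theorem numEdges_map {V W : Type*} (f : V ↪ W) (G : SimpleGraph V) :
    numEdges (G.map f) = numEdges G := by
  rw [numEdges, numEdges, edgeSet_map]
  exact Set.ncard_image_of_injective _ f.sym2Map.injective

theorem numEdges_mono {V : Type*} [Finite V] {G H : SimpleGraph V} (h : G ≤ H) :
    numEdges G ≤ numEdges H :=
  Set.ncard_le_ncard (edgeSet_mono h) (Set.toFinite _)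

theorem numEdges_le_of_isContained {V W : Type*} [Finite V] {H : SimpleGraph W}
    {U : SimpleGraph V} (h : H ⊑ U) : numEdges H ≤ numEdges U := by
  obtain ⟨φ, hφ⟩ := isContained_iff_exists_le_comap.mp h
  rw [← numEdges_map φ H]
  exact numEdges_mono ((map_le_iff_le_comap φ H U).mpr hφ)

theorem numEdges_add_numEdges_compl {V : Type*} [Fintype V] (G : SimpleGraph V) :
    numEdges G + numEdges Gᶜ = (Fintype.card V).choose 2 := by
  classical
  rw [← card_edgeFinset_top_eq_card_choose_two, ← numEdges_eq_card,
    ← sup_compl_eq_top (x := G), numEdges, numEdges, numEdges, edgeSet_sup,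
    Set.ncard_union_eq ((disjoint_edgeSet).mpr disjoint_compl_right)]

theorem numEdges_add_numEdges_compl_fin {n : ℕ} (G : SimpleGraph (Fin n)) :
    numEdges G + numEdges Gᶜ = n.choose 2 := by
  rw [numEdges_add_numEdges_compl, Fintype.card_fin]

theorem numEdges_le_choose {V : Type*} [Fintype V] (G : SimpleGraph V) :
    numEdges G ≤ (Fintype.card V).choose 2 :=
  (Nat.le_add_right _ _).trans (numEdges_add_numEdges_compl G).le

theorem univMin_le {n m : ℕ} {U : SimpleGraph (Fin n)} (h : IsUniversal n m U) :
    univMin n m ≤ numEdges U :=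
  (univMin_isLeast n m).2 ⟨U, h, rfl⟩

theorem univMin_le_choose (n m : ℕ) : univMin n m ≤ n.choose 2 := by
  obtain ⟨U, -, hU⟩ := (univMin_isLeast n m).1
  simpa only [hU, Fintype.card_fin] using numEdges_le_choose U

theorem exists_perm_comp_eq {V W : Type*} [Finite V] (ι φ : W ↪ V) :
    ∃ σ : Equiv.Perm V, ∀ w, σ (ι w) = φ w := by
  classical
  let e : Set.range ι ≃ Set.range φ :=
    (Equiv.ofInjective ι ι.injective).symm.trans (Equiv.ofInjective φ φ.injective)
  refine ⟨e.extendSubtype, fun w => ?_⟩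
  rw [e.extendSubtype_apply_of_mem _ ⟨w, rfl⟩]
  simp only [e, Equiv.trans_apply]
  rw [Equiv.ofInjective_symm_apply, Equiv.ofInjective_apply]

theorem isContained_map_left {V W : Type*} [Finite V] {G : SimpleGraph W} {H : SimpleGraph V}
    (ι : W ↪ V) (h : G ⊑ H) : G.map ι ⊑ H := by
  obtain ⟨φ, hφ⟩ := isContained_iff_exists_le_comap.mp h
  obtain ⟨σ, hσ⟩ := exists_perm_comp_eq ι φ
  refine isContained_iff_exists_le_comap.mpr ⟨σ.toEmbedding, ?_⟩
  rw [map_le_iff_le_comap, comap_comap]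
  intro a b hab
  simpa [hσ] using hφ hab

theorem isContained_compl {V : Type*} [Finite V] {G H : SimpleGraph V} (h : G ⊑ H) :
    Hᶜ ⊑ Gᶜ := by
  obtain ⟨φ, hφ⟩ := isContained_iff_exists_le_comap.mp h
  let σ : V ≃ V := Equiv.ofBijective φ (Finite.injective_iff_bijective.mp φ.injective)
  refine isContained_iff_exists_le_comap.mpr ⟨σ.symm.toEmbedding, fun a b hab => ?_⟩
  rw [compl_adj] at hab
  rw [comap_adj, compl_adj]
  refine ⟨σ.symm.injective.ne hab.1, fun hG => hab.2 ?_⟩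
  have hH : H.Adj (σ (σ.symm a)) (σ (σ.symm b)) := hφ hG
  simpa only [Equiv.apply_symm_apply] using hH

theorem isUnavoidable_compl_of_isUniversal {n e m : ℕ} (h : e + m = n.choose 2)
    {U : SimpleGraph (Fin n)} (hU : IsUniversal n m U) : IsUnavoidable n e Uᶜ := by
  intro G hG
  have hGc : numEdges Gᶜ = m := by
    have := numEdges_add_numEdges_compl_fin G
    omega
  simpa only [compl_compl] using isContained_compl (hU _ hGc)

theorem isUniversal_compl_map_of_isUnavoidable {n e m : ℕ} (h : e + m = n.choose 2)
    {W : Type*} {F : SimpleGraph W} (hF : IsUnavoidable n e F) (ι : W ↪ Fin n) :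
    IsUniversal n m (F.map ι)ᶜ := by
  intro G hG
  have hGc : numEdges Gᶜ = e := by
    have := numEdges_add_numEdges_compl_fin G
    omega
  simpa only [compl_compl] using isContained_compl (isContained_map_left ι (hF _ hGc))

theorem univMin_add_unavoidMax {n e m : ℕ} (h : e + m = n.choose 2) :
    univMin n m + unavoidMax n e = n.choose 2 := by
  have he : e ≤ n.choose 2 := h ▸ Nat.le_add_right e m
  apply le_antisymm
  · obtain ⟨k, F, hF, hFe⟩ := (unavoidMax_isGreatest he).1
    obtain ⟨G, hG⟩ := exists_numEdges_eq he
    obtain ⟨ι, -⟩ := isContained_iff_exists_le_comap.mp (hF G hG)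
    have hU := univMin_le (isUniversal_compl_map_of_isUnavoidable h hF ι)
    have hsum := numEdges_add_numEdges_compl_fin (F.map ι)
    rw [numEdges_map] at hsum
    omega
  · obtain ⟨U, hU, hUe⟩ := (univMin_isLeast n m).1
    have hF := (unavoidMax_isGreatest he).2
      ⟨n, Uᶜ, isUnavoidable_compl_of_isUniversal h hU, rfl⟩
    have hsum := numEdges_add_numEdges_compl_fin U
    omega

theorem ncard_support_le {V : Type*} [Finite V] (G : SimpleGraph V) :
    G.support.ncard ≤ 2 * numEdges G := by
  classical
  have := Fintype.ofFinite V
  have hsub : G.support ⊆ (G.edgeFinset.biUnion Sym2.toFinset : Finset V) := by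
    rintro v ⟨w, hvw⟩
    simp only [Finset.coe_biUnion, Set.mem_iUnion]
    exact ⟨s(v, w), by simpa using hvw, by simp⟩
  calc G.support.ncard ≤ (G.edgeFinset.biUnion Sym2.toFinset).card := by
        simpa only [Set.ncard_coe_finset] using Set.ncard_le_ncard hsub
    _ ≤ G.edgeFinset.card * 2 := Finset.card_biUnion_le_card_mul _ _ _ fun e _ =>
        (Sym2.card_toFinset e).trans_le (by split_ifs <;> simp)
    _ = 2 * numEdges G := by rw [numEdges_eq_card, mul_comm]

theorem map_comap_eq_of_support_subset_range {V W : Type*} (f : W ↪ V) {G : SimpleGraph V}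
    (h : G.support ⊆ Set.range f) : (G.comap f).map f = G := by
  refine le_antisymm (map_comap_le f G) fun a b hab => ?_
  obtain ⟨u, rfl⟩ := h hab.mem_support_left
  obtain ⟨v, rfl⟩ := h hab.mem_support_right
  exact (map_adj _ _ _ _).mpr ⟨u, v, hab, rfl, rfl⟩

theorem exists_embedding_range_supset {n k : ℕ} (hk : k ≤ n) {S : Set (Fin n)}
    (hS : S.ncard ≤ k) : ∃ f : Fin k ↪ Fin n, S ⊆ Set.range f := by
  classical
  obtain ⟨T, hST, hT⟩ := Finset.exists_superset_card_eq (s := S.toFinset) (n := k)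
    (by rwa [← Set.ncard_eq_toFinset_card']) (by simpa using hk)
  exact ⟨(T.orderEmbOfFin hT).toEmbedding, fun v hv => by
    simpa using hST (Set.mem_toFinset.mpr hv)⟩

theorem isUniversal_map_castLEEmb {n k m : ℕ} (hm : 2 * m ≤ k) (hk : k ≤ n)
    {U : SimpleGraph (Fin k)} (hU : IsUniversal k m U) :
    IsUniversal n m (U.map (Fin.castLEEmb hk)) := by
  intro H hH
  obtain ⟨f, hf⟩ := exists_embedding_range_supset hk
    ((ncard_support_le H).trans (by rw [hH]; exact hm))
  have hmap := map_comap_eq_of_support_subset_range f hf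
  rw [← hmap]
  refine isContained_map_left f ((hU (H.comap f) ?_).trans (Embedding.map _ U).isContained)
  rw [← numEdges_map f, hmap, hH]

theorem univMin_le_of_le {n k m : ℕ} (hm : 2 * m ≤ k) (hk : k ≤ n) :
    univMin n m ≤ univMin k m := by
  obtain ⟨U, hU, hUe⟩ := (univMin_isLeast k m).1
  rw [← hUe, ← numEdges_map (Fin.castLEEmb hk) U]
  exact univMin_le (isUniversal_map_castLEEmb hm hk hU)

theorem ncard_setOf_le_and_numEdges_eq {V : Type*} [Finite V] (U : SimpleGraph V) (m : ℕ) :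
    {K : SimpleGraph V | K ≤ U ∧ numEdges K = m}.ncard = (numEdges U).choose m := by
  classical
  have := Fintype.ofFinite V
  rw [numEdges_eq_card, ← Finset.card_powersetCard, ← Set.ncard_coe_finset]
  refine Set.ncard_congr (fun K _ => K.edgeFinset) (fun K hK => ?_)
    (fun K L _ _ h => edgeFinset_inj.mp h) (fun S hS => ?_)
  · rw [Finset.mem_coe, Finset.mem_powersetCard, ← numEdges_eq_card]
    exact ⟨edgeFinset_mono hK.1, hK.2⟩
  · obtain ⟨hSU, hcard⟩ := Finset.mem_powersetCard.mp (Finset.mem_coe.mp hS)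
    have hdiag : ∀ e ∈ S, ¬ e.IsDiag := fun e he =>
      not_isDiag_of_mem_edgeSet U (mem_edgeFinset.mp (hSU he))
    have hedge : (fromEdgeSet (S : Set (Sym2 V))).edgeFinset = S := by
      ext e
      simpa using hdiag e
    refine ⟨fromEdgeSet S, ⟨?_, ?_⟩, by convert hedge⟩
    · exact edgeFinset_subset_edgeFinset.mp (hedge.trans_subset hSU)
    · rw [numEdges_eq_card, hedge, hcard]

-- `H` is recovered from its image `K` in `U` and the partial map `ψ` to the support of `U`; the
-- vertices that `ψ` sends to `none` are isolated in `H`.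
theorem exists_comap_eq_of_isContained {V W : Type*} {H : SimpleGraph W} {U : SimpleGraph V}
    (h : H ⊑ U) : ∃ (ψ : W → Option U.support) (K : SimpleGraph V), K ≤ U ∧
      numEdges K = numEdges H ∧ ((K.induce U.support).map Function.Embedding.some).comap ψ = H := by
  classical
  obtain ⟨φ, hφ⟩ := isContained_iff_exists_le_comap.mp h
  let ψ : W → Option U.support := fun w => if hw : φ w ∈ U.support then some ⟨φ w, hw⟩ else none
  have hψ_some : ∀ {w} (hw : φ w ∈ U.support), ψ w = some ⟨φ w, hw⟩ := fun hw => dif_pos hw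
  have hψ : ∀ {w v}, some v = ψ w → (v : V) = φ w := by
    intro w v hv
    by_cases hw : φ w ∈ U.support
    · rw [hψ_some hw] at hv
      rw [Option.some_injective _ hv]
    · rw [show ψ w = none from dif_neg hw] at hv
      exact absurd hv (Option.some_ne_none v)
  refine ⟨ψ, H.map φ, (map_le_iff_le_comap φ H U).mpr hφ, numEdges_map φ H, ?_⟩
  ext a b
  rw [comap_adj, map_adj]
  constructor
  · rintro ⟨u, v, huv, hu, hv⟩
    rw [comap_adj] at huv
    change (H.map φ).Adj u v at huv
    rwa [hψ hu, hψ hv, map_adj_apply] at huv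
  · intro hab
    have hU : U.Adj (φ a) (φ b) := hφ hab
    exact ⟨⟨φ a, hU.mem_support_left⟩, ⟨φ b, hU.mem_support_right⟩, map_adj_apply.mpr hab,
      (hψ_some hU.mem_support_left).symm, (hψ_some hU.mem_support_right).symm⟩

theorem ncard_setOf_isContained_le {V W : Type*} [Finite V] [Fintype W] (U : SimpleGraph V)
    (m : ℕ) : {H : SimpleGraph W | numEdges H = m ∧ H ⊑ U}.ncard ≤
      (U.support.ncard + 1) ^ Fintype.card W * (numEdges U).choose m := by
  classical
  have := Fintype.ofFinite V
  let P : Set ((W → Option U.support) × SimpleGraph V) :=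
    Set.univ ×ˢ {K | K ≤ U ∧ numEdges K = m}
  let decode : (W → Option U.support) × SimpleGraph V → SimpleGraph W :=
    fun p => ((p.2.induce U.support).map Function.Embedding.some).comap p.1
  have hsub : {H : SimpleGraph W | numEdges H = m ∧ H ⊑ U} ⊆ decode '' P := by
    rintro H ⟨rfl, hH⟩
    obtain ⟨ψ, K, hKU, hKe, hKH⟩ := exists_comap_eq_of_isContained hH
    exact ⟨(ψ, K), ⟨Set.mem_univ ψ, hKU, hKe⟩, hKH⟩
  calc _ ≤ (decode '' P).ncard := Set.ncard_le_ncard hsub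
    _ ≤ P.ncard := Set.ncard_image_le
    _ = (U.support.ncard + 1) ^ Fintype.card W * (numEdges U).choose m := by
      rw [Set.ncard_prod, ncard_setOf_le_and_numEdges_eq, Set.ncard_univ, Nat.card_eq_fintype_card,
        Fintype.card_fun, Fintype.card_option, ← Nat.card_eq_fintype_card, Nat.card_coe_set_eq]

theorem choose_le_of_isUniversal {V : Type*} [Finite V] {n m k : ℕ} (hk : k ≤ n)
    {U : SimpleGraph V} (hU : IsUniversal n m U) :
    (k.choose 2).choose m ≤ (U.support.ncard + 1) ^ k * (numEdges U).choose m := by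
  have hcontained : ∀ H : SimpleGraph (Fin k), numEdges H = m → H ⊑ U := fun H hH =>
    (Embedding.map (Fin.castLEEmb hk) H).isContained.trans
      (hU _ ((numEdges_map (Fin.castLEEmb hk) H).trans hH))
  calc (k.choose 2).choose m
      = {H : SimpleGraph (Fin k) | H ≤ ⊤ ∧ numEdges H = m}.ncard := by
        rw [ncard_setOf_le_and_numEdges_eq, numEdges_eq_card,
          card_edgeFinset_top_eq_card_choose_two, Fintype.card_fin]
    _ ≤ {H : SimpleGraph (Fin k) | numEdges H = m ∧ H ⊑ U}.ncard :=
        Set.ncard_le_ncard fun H hH => ⟨hH.2, hcontained H hH.2⟩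
    _ ≤ (U.support.ncard + 1) ^ k * (numEdges U).choose m := by
        simpa only [Fintype.card_fin] using ncard_setOf_isContained_le (W := Fin k) U m

theorem descFactorial_mul_pow_le {g N : ℕ} (h : g ≤ N) (m : ℕ) :
    g.descFactorial m * N ^ m ≤ N.descFactorial m * g ^ m := by
  induction m with
  | zero => simp
  | succ m ih =>
    rw [Nat.descFactorial_succ, Nat.descFactorial_succ, pow_succ, pow_succ]
    have hfactor : (g - m) * N ≤ (N - m) * g := by
      rw [Nat.sub_mul, Nat.sub_mul, mul_comm N g]
      exact Nat.sub_le_sub_left (Nat.mul_le_mul_left m h) _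
    calc (g - m) * g.descFactorial m * (N ^ m * N)
        = (g.descFactorial m * N ^ m) * ((g - m) * N) := by ring
      _ ≤ (N.descFactorial m * g ^ m) * ((N - m) * g) := Nat.mul_le_mul ih hfactor
      _ = (N - m) * N.descFactorial m * (g ^ m * g) := by ring

theorem choose_mul_pow_le {g N : ℕ} (h : g ≤ N) (m : ℕ) :
    g.choose m * N ^ m ≤ N.choose m * g ^ m := by
  have := descFactorial_mul_pow_le h m
  rw [Nat.descFactorial_eq_factorial_mul_choose, Nat.descFactorial_eq_factorial_mul_choose,
    mul_assoc, mul_assoc] at this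
  exact Nat.le_of_mul_le_mul_left this m.factorial_pos

theorem le_numEdges_of_isUniversal {V : Type*} [Finite V] {n m : ℕ} (hm : m ≤ n.choose 2)
    {U : SimpleGraph V} (hU : IsUniversal n m U) : m ≤ numEdges U := by
  obtain ⟨H, hH⟩ := exists_numEdges_eq hm
  exact hH ▸ numEdges_le_of_isContained (hU H hH)

theorem choose_two_pow_le {V : Type*} [Finite V] {n m k : ℕ} (hk : k ≤ n) (hm : m ≤ n.choose 2)
    {U : SimpleGraph V} (hU : IsUniversal n m U) (hUk : numEdges U ≤ k.choose 2) :
    (k.choose 2) ^ m ≤ (U.support.ncard + 1) ^ k * numEdges U ^ m := by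
  refine Nat.le_of_mul_le_mul_left ?_ (Nat.choose_pos (le_numEdges_of_isUniversal hm hU))
  calc (numEdges U).choose m * (k.choose 2) ^ m
      ≤ (k.choose 2).choose m * numEdges U ^ m := choose_mul_pow_le hUk m
    _ ≤ (U.support.ncard + 1) ^ k * (numEdges U).choose m * numEdges U ^ m :=
        Nat.mul_le_mul_right _ (choose_le_of_isUniversal hk hU)
    _ = (numEdges U).choose m * ((U.support.ncard + 1) ^ k * numEdges U ^ m) := by ring

theorem pow_three_pow_le {m k : ℕ} (hm : 0 < m) (hk : k * Real.log m ≤ m) :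
    ((m : ℝ) ^ 3) ^ k ≤ 27 ^ m := by
  have hpow : (m : ℝ) ^ k ≤ Real.exp 1 ^ m := by
    calc (m : ℝ) ^ k = Real.exp (k * Real.log m) := by
          rw [Real.exp_nat_mul, Real.exp_log (by exact_mod_cast hm)]
      _ ≤ Real.exp m := Real.exp_le_exp.mpr hk
      _ = Real.exp 1 ^ m := (Real.exp_one_pow m).symm
  calc ((m : ℝ) ^ 3) ^ k = ((m : ℝ) ^ k) ^ 3 := pow_right_comm _ _ _
    _ ≤ (3 ^ m) ^ 3 := by
        gcongr
        refine hpow.trans ?_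
        gcongr
        exact Real.exp_one_lt_d9.le.trans (by norm_num)
    _ = 27 ^ m := by rw [pow_right_comm]; norm_num

theorem choose_two_le_mul_numEdges {V : Type*} [Finite V] {n m k : ℕ} (hk : k ≤ n)
    (hkm : k * Real.log m ≤ m) (hm : m ≤ n.choose 2) (hm2 : 2 ≤ m) {U : SimpleGraph V}
    (hU : IsUniversal n m U) : (k.choose 2 : ℝ) ≤ 27 * numEdges U := by
  have hm2' : (2 : ℝ) ≤ m := by exact_mod_cast hm2
  by_cases hUk : k.choose 2 ≤ numEdges U
  · have : (k.choose 2 : ℝ) ≤ numEdges U := by exact_mod_cast hUk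
    linarith [(numEdges U).cast_nonneg (α := ℝ)]
  by_cases hUm : m ^ 2 ≤ numEdges U
  · have hlog : 1 / 2 ≤ Real.log m := by
      linarith [Real.log_two_gt_d9, Real.log_le_log two_pos hm2']
    have hk2 : (k : ℝ) ≤ 2 * m := by nlinarith [k.cast_nonneg (α := ℝ)]
    calc (k.choose 2 : ℝ) ≤ (k : ℝ) ^ 2 := by exact_mod_cast Nat.choose_le_pow k 2
      _ ≤ (2 * m) ^ 2 := by gcongr
      _ ≤ 27 * (m : ℝ) ^ 2 := by nlinarith [sq_nonneg (m : ℝ)]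
      _ ≤ 27 * numEdges U := by
          gcongr
          exact_mod_cast hUm
  have hsupp : U.support.ncard + 1 ≤ m ^ 3 := by
    have hcube : 2 * m ^ 2 ≤ m ^ 3 := by
      rw [pow_succ' m 2]
      exact Nat.mul_le_mul_right _ hm2
    have := ncard_support_le U
    omega
  have hpow : (k.choose 2 : ℝ) ^ m ≤ (27 * numEdges U) ^ m := by
    calc (k.choose 2 : ℝ) ^ m ≤ ((U.support.ncard + 1 : ℕ) : ℝ) ^ k * (numEdges U : ℝ) ^ m := by
          exact_mod_cast choose_two_pow_le hk hm hU (not_le.mp hUk).le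
      _ ≤ ((m : ℝ) ^ 3) ^ k * (numEdges U : ℝ) ^ m := by
          gcongr
          exact_mod_cast hsupp
      _ ≤ 27 ^ m * (numEdges U : ℝ) ^ m := by
          gcongr
          exact pow_three_pow_le (by omega) hkm
      _ = (27 * numEdges U) ^ m := (mul_pow _ _ _).symm
  exact le_of_pow_le_pow_left₀ (by omega) (by positivity) hpow

theorem sq_le_choose_two_floor {x : ℝ} (hx : 9 ≤ x) : x ^ 2 ≤ 3 * (⌊x⌋₊.choose 2 : ℝ) := by
  have hfloor := Nat.lt_floor_add_one x
  have : (x - 1) * (x - 2) ≤ (⌊x⌋₊ : ℝ) * (⌊x⌋₊ - 1) :=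
    mul_le_mul (by linarith) (by linarith) (by linarith) (by linarith)
  rw [Nat.cast_choose_two]
  nlinarith

theorem div_log_le_of_le_mul_log {n m : ℕ} (hm : 1 ≤ Real.log m) (h : (m : ℝ) ≤ n * Real.log n) :
    (m : ℝ) / Real.log m ≤ n := by
  rw [div_le_iff₀ (by linarith)]
  rcases le_total n m with hnm | hmn
  · refine h.trans ?_
    rcases Nat.eq_zero_or_pos n with rfl | hn
    · simp
    · gcongr
  · have hmn' : (m : ℝ) ≤ n := by exact_mod_cast hmn
    nlinarith

theorem sq_div_log_le_univMin {n m : ℕ} (hm : m ≤ n.choose 2) (hm2 : 2 ≤ m)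
    (hmn : (m : ℝ) ≤ n * Real.log n) :
    1 / 81 * ((m : ℝ) ^ 2 / Real.log m ^ 2) ≤ univMin n m := by
  obtain ⟨U, hU, hUe⟩ := (univMin_isLeast n m).1
  rw [← hUe, ← div_pow]
  have hm2' : (2 : ℝ) ≤ m := by exact_mod_cast hm2
  have hlog2 : 1 / 2 < Real.log m := by
    linarith [Real.log_two_gt_d9, Real.log_le_log two_pos hm2']
  have hratio : 0 < (m : ℝ) / Real.log m := div_pos (by linarith) (by linarith)
  rcases lt_or_ge ((m : ℝ) / Real.log m) 9 with hsmall | hlarge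
  · have hmU : (m : ℝ) ≤ numEdges U := by exact_mod_cast le_numEdges_of_isUniversal hm hU
    nlinarith
  · have hlog : 1 ≤ Real.log m := by
      rw [le_div_iff₀ (by linarith)] at hlarge
      rw [Real.le_log_iff_exp_le (by linarith)]
      linarith [Real.exp_one_lt_d9]
    have hfloor : (⌊(m : ℝ) / Real.log m⌋₊ : ℝ) ≤ m / Real.log m := Nat.floor_le hratio.le
    have hk : ⌊(m : ℝ) / Real.log m⌋₊ ≤ n :=
      Nat.floor_le_of_le (div_log_le_of_le_mul_log hlog hmn)
    have := choose_two_le_mul_numEdges hk ((le_div_iff₀ (by linarith)).mp hfloor) hm hm2 hU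
    linarith [sq_le_choose_two_floor hlarge]

theorem exists_independent_subset {α : Type*} {r : α → α → Prop} [DecidableRel r]
    (hr : Std.Symm r) {d : ℕ} (x : ℕ) (X : Finset α)
    (hd : ∀ v ∈ X, (X.filter (r v)).card ≤ d) (hX : x * (d + 1) ≤ X.card) :
    ∃ I ⊆ X, I.card = x ∧ (I : Set α).Pairwise fun u v => ¬ r u v := by
  classical
  induction x generalizing X with
  | zero => exact ⟨∅, by simp⟩
  | succ x ih =>
    obtain ⟨v, hv⟩ := Finset.card_pos.mp (lt_of_lt_of_le (by positivity) hX)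
    let K := insert v (X.filter (r v))
    have hK : K.card ≤ d + 1 :=
      (Finset.card_insert_le _ _).trans (Nat.add_le_add_right (hd v hv) 1)
    obtain ⟨I, hI, hIcard, hIr⟩ := ih (X \ K)
      (fun u hu => (Finset.card_le_card (Finset.filter_subset_filter _ Finset.sdiff_subset)).trans
        (hd u (Finset.mem_sdiff.mp hu).1))
      (by
        have := Finset.le_card_sdiff K X
        have := add_one_mul x (d + 1)
        omega)
    have hvI : v ∉ I := fun h => (Finset.mem_sdiff.mp (hI h)).2 (Finset.mem_insert_self _ _)
    have hvr : ∀ u ∈ I, ¬ r v u := fun u hu huv => by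
      obtain ⟨huX, huK⟩ := Finset.mem_sdiff.mp (hI hu)
      exact huK (Finset.mem_insert_of_mem (Finset.mem_filter.mpr ⟨huX, huv⟩))
    refine ⟨insert v I, Finset.insert_subset hv fun u hu => (Finset.mem_sdiff.mp (hI hu)).1,
      by rw [Finset.card_insert_of_notMem hvI, hIcard], ?_⟩
    rw [Finset.coe_insert]
    exact hIr.insert fun u hu _ => ⟨hvr u hu, fun huv => hvr u hu (hr.symm _ _ huv)⟩

/-- The expansion property that drives the greedy embedding: among any `x` disjoint sets of at most
`Δ` vertices of `X`, some set is completely joined by `R` to one of any `y` vertices of `Z` outside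
these sets. The relation is a set of pairs so that it can be an edge set as well as a colour
class. -/
def IsExpanding {V : Type*} (R : Set (Sym2 V)) (X Z : Finset V) (x y Δ : ℕ) : Prop :=
  ∀ (N : Fin x → Finset V) (Y : Finset V), Pairwise (Function.onFun Disjoint N) →
    (∀ i, N i ⊆ X) → (∀ i, (N i).card ≤ Δ) → Y ⊆ Z → Y.card = y → (∀ i, Disjoint (N i) Y) →
    ∃ i, ∃ b ∈ Y, ∀ u ∈ N i, s(u, b) ∈ R

section Embedding

variable {V W : Type*}

/-- A partial embedding of `H` into `U` with domain `S` that respects the first `G` levels: the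
vertices of the group `D j` are placed in the slots `B j`. -/
structure IsPartialEmbedding (H : SimpleGraph W) (U : SimpleGraph V) (D : ℕ → Finset W)
    (B : ℕ → Finset V) (G : ℕ) (S : Finset W) (φ : W → V) : Prop where
  mem : ∀ w ∈ S, ∃ j < G, w ∈ D j ∧ φ w ∈ B j
  injOn : Set.InjOn φ S
  adj : ∀ a ∈ S, ∀ b ∈ S, H.Adj a b → U.Adj (φ a) (φ b)

/-- The groups `D j` are disjoint, and `I` is an independent set without neighbours in any group.
The vertices of `I` are embedded last, wherever the greedy placement has left a gap. -/
structure IsVertexGrouping (H : SimpleGraph W) (I : Finset W) (D : ℕ → Finset W) : Prop where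
  pairwise_disjoint : Pairwise (Function.onFun Disjoint D)
  disjoint : ∀ j, Disjoint I (D j)
  notMem_of_adj : ∀ v ∈ I, ∀ w, H.Adj v w → w ∉ I ∧ ∀ j, w ∉ D j

variable {H : SimpleGraph W} {U : SimpleGraph V} {D : ℕ → Finset W} {B : ℕ → Finset V}
  {G : ℕ} {S : Finset W} {φ : W → V}

theorem IsPartialEmbedding.mono (h : IsPartialEmbedding H U D B G S φ) {G' : ℕ} (hG : G ≤ G') :
    IsPartialEmbedding H U D B G' S φ :=
  ⟨fun w hw => (h.mem w hw).imp fun _ hj => ⟨hj.1.trans_le hG, hj.2⟩, h.injOn, h.adj⟩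

theorem IsPartialEmbedding.card_inter_le [DecidableEq W] (h : IsPartialEmbedding H U D B G S φ)
    (hD : Pairwise (Function.onFun Disjoint D)) (g : ℕ) : (S ∩ D g).card ≤ (B g).card := by
  refine Finset.card_le_card_of_injOn φ (fun w hw => ?_)
    (h.injOn.mono (Finset.coe_subset.mpr Finset.inter_subset_left))
  obtain ⟨hwS, hwg⟩ := Finset.mem_inter.mp (Finset.mem_coe.mp hw)
  obtain ⟨j, -, hwj, hφ⟩ := h.mem w hwS
  obtain rfl : j = g := by
    by_contra hne
    exact Finset.disjoint_left.mp (hD hne) hwj hwg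
  exact hφ

theorem IsPartialEmbedding.insert_update [DecidableEq V] [DecidableEq W]
    (h : IsPartialEmbedding H U D B G S φ) {g : ℕ} (hg : g < G) {v : W}
    (hv : v ∉ S) (hvD : v ∈ D g) {b : V} (hbB : b ∈ B g) (hb : b ∉ S.image φ)
    (hadj : ∀ w ∈ S, H.Adj v w → U.Adj (φ w) b) :
    IsPartialEmbedding H U D B G (insert v S) (Function.update φ v b) := by
  have hold : ∀ w ∈ S, Function.update φ v b w = φ w := fun w hw =>
    Function.update_of_ne (ne_of_mem_of_not_mem hw hv) _ _
  have hnew : Function.update φ v b v = b := Function.update_self _ _ _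
  refine ⟨fun w hw => ?_, ?_, fun w hw w' hw' hww => ?_⟩
  · rcases Finset.mem_insert.mp hw with rfl | hw
    · exact ⟨g, hg, hvD, hnew.symm ▸ hbB⟩
    · rw [hold w hw]
      exact h.mem w hw
  · rw [Finset.coe_insert, Set.injOn_insert (by simpa using hv)]
    refine ⟨h.injOn.congr fun w hw => (hold w hw).symm, ?_⟩
    rintro ⟨w, hw, hwb⟩
    rw [hnew, hold w hw] at hwb
    exact hb (hwb ▸ Finset.mem_image_of_mem φ hw)
  · rcases Finset.mem_insert.mp hw with hwv | hwS <;>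
      rcases Finset.mem_insert.mp hw' with hwv' | hwS'
    · exact absurd (hwv.trans hwv'.symm) hww.ne
    · subst hwv
      rw [hnew, hold w' hwS']
      exact (hadj w' hwS' hww).symm
    · subst hwv'
      rw [hnew, hold w hwS]
      exact hadj w hwS hww.symm
    · rw [hold w hwS, hold w' hwS']
      exact h.adj w hwS w' hwS' hww

variable [Fintype W] [DecidableRel H.Adj]

theorem IsPartialEmbedding.exists_unplaced [DecidableEq W]
    (h : IsPartialEmbedding H U D B G S φ)
    (hD : Pairwise (Function.onFun Disjoint D)) {P : ℕ} (hP : ∀ j, ∀ v ∈ D j, H.degree v ≤ P)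
    {x g : ℕ} (hcard : (B g).card + x * (P * P + 1) ≤ (D g).card) :
    ∃ I ⊆ D g \ S, I.card = x ∧ (I : Set W).Pairwise fun u v =>
      Disjoint (S ∩ H.neighborFinset u) (S ∩ H.neighborFinset v) := by
  have hX : x * (P * P + 1) ≤ (D g \ S).card := by
    have := Finset.card_sdiff_add_card_inter (D g) S
    have := h.card_inter_le hD g
    rw [Finset.inter_comm] at this
    omega
  have hclose : ∀ v ∈ D g \ S, ((D g \ S).filter fun u =>
      ¬ Disjoint (S ∩ H.neighborFinset v) (S ∩ H.neighborFinset u)).card ≤ P * P := by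
    intro v hv
    have hsub : ((D g \ S).filter fun u =>
        ¬ Disjoint (S ∩ H.neighborFinset v) (S ∩ H.neighborFinset u)) ⊆
          (H.neighborFinset v ∩ S).biUnion fun w => H.neighborFinset w := by
      intro u hu
      obtain ⟨w, hwv, hwu⟩ := Finset.not_disjoint_iff.mp (Finset.mem_filter.mp hu).2
      rw [Finset.mem_inter, mem_neighborFinset] at hwv hwu
      rw [Finset.mem_biUnion]
      exact ⟨w, by simp [hwv.1, hwv.2], by simpa using hwu.2.symm⟩
    refine (Finset.card_le_card hsub).trans
      ((Finset.card_biUnion_le_card_mul _ _ P fun w hw => ?_).trans (Nat.mul_le_mul_right _ ?_))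
    · obtain ⟨j, -, hwj, -⟩ := h.mem w (Finset.mem_inter.mp hw).2
      exact hP j w hwj
    · exact (Finset.card_le_card Finset.inter_subset_left).trans (hP g v (Finset.mem_sdiff.mp hv).1)
  obtain ⟨I, hI, hIcard, hpair⟩ := exists_independent_subset
    (r := fun u v => ¬ Disjoint (S ∩ H.neighborFinset u) (S ∩ H.neighborFinset v))
    ⟨fun _ _ huv hvu => huv hvu.symm⟩ x (D g \ S) hclose hX
  exact ⟨I, hI, hIcard, hpair.imp fun _ _ => not_not.mp⟩

theorem IsPartialEmbedding.exists_extension [DecidableEq V] [DecidableEq W] {g : ℕ}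
    (h : IsPartialEmbedding H U D B (g + 1) S φ) {x y Δ P : ℕ}
    (hD : Pairwise (Function.onFun Disjoint D)) (hP : ∀ j, ∀ v ∈ D j, H.degree v ≤ P)
    (hΔ : ∀ v ∈ D g, H.degree v ≤ Δ) (hcard : (B g).card + x * (P * P + 1) ≤ (D g).card)
    (hU : IsExpanding U.edgeSet ((Finset.range (g + 1)).biUnion B) (B g) x y Δ)
    (hfree : y ≤ (B g \ S.image φ).card) :
    ∃ v ∉ S, ∃ ψ, IsPartialEmbedding H U D B (g + 1) (insert v S) ψ ∧ Set.EqOn ψ φ S := by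
  obtain ⟨I, hI, hIcard, hpair⟩ := h.exists_unplaced hD hP hcard
  let f : Fin x ≃ I := (Finset.equivFinOfCardEq hIcard).symm
  have hf : ∀ i, (f i : W) ∈ D g ∧ (f i : W) ∉ S := fun i => Finset.mem_sdiff.mp (hI (f i).2)
  obtain ⟨Y, hY, hYcard⟩ := Finset.exists_subset_card_eq hfree
  obtain ⟨i, b, hb, hadj⟩ := hU (fun i => (S ∩ H.neighborFinset (f i)).image φ) Y
    (fun i j hij => by
      rw [Function.onFun, ← Finset.disjoint_coe, Finset.coe_image, Finset.coe_image]
      exact Set.disjoint_image_image fun a ha a' ha' haa => Finset.disjoint_left.mp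
        (hpair (f i).2 (f j).2 fun hfij => hij (f.injective (Subtype.ext hfij)))
        ha ((h.injOn (Finset.mem_inter.mp ha).1 (Finset.mem_inter.mp ha').1 haa).symm ▸ ha'))
    (fun i u hu => by
      obtain ⟨a, ha, rfl⟩ := Finset.mem_image.mp hu
      obtain ⟨j, hj, -, hφ⟩ := h.mem a (Finset.mem_inter.mp ha).1
      exact Finset.mem_biUnion.mpr ⟨j, Finset.mem_range.mpr hj, hφ⟩)
    (fun i => Finset.card_image_le.trans
      ((Finset.card_le_card Finset.inter_subset_right).trans (hΔ _ (hf i).1)))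
    (hY.trans Finset.sdiff_subset) hYcard
    (fun i => Finset.disjoint_of_subset_left (Finset.image_subset_image Finset.inter_subset_left)
      (Finset.disjoint_of_subset_right hY Finset.disjoint_sdiff))
  obtain ⟨hbB, hbφ⟩ := Finset.mem_sdiff.mp (hY hb)
  refine ⟨f i, (hf i).2, Function.update φ (f i) b,
    h.insert_update g.lt_succ_self (hf i).2 (hf i).1 hbB hbφ fun w hw hvw => ?_, fun w hw =>
    Function.update_of_ne (ne_of_mem_of_not_mem hw (hf i).2) _ _⟩
  exact hadj _ (Finset.mem_image_of_mem φ
    (Finset.mem_inter.mpr ⟨hw, (mem_neighborFinset _ _ _).mpr hvw⟩))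

theorem IsPartialEmbedding.exists_fill_level [DecidableEq V] {g : ℕ}
    (h : IsPartialEmbedding H U D B (g + 1) S φ) {x y Δ P : ℕ}
    (hD : Pairwise (Function.onFun Disjoint D)) (hP : ∀ j, ∀ v ∈ D j, H.degree v ≤ P)
    (hΔ : ∀ v ∈ D g, H.degree v ≤ Δ) (hcard : (B g).card + x * (P * P + 1) ≤ (D g).card)
    (hU : IsExpanding U.edgeSet ((Finset.range (g + 1)).biUnion B) (B g) x y Δ) :
    ∃ T ψ, IsPartialEmbedding H U D B (g + 1) T ψ ∧ S.image φ ⊆ T.image ψ ∧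
      (B g \ T.image ψ).card < y := by
  classical
  induction hk : Fintype.card W - S.card using Nat.strong_induction_on generalizing S φ with
  | _ k ih =>
    by_cases hfree : (B g \ S.image φ).card < y
    · exact ⟨S, φ, h, subset_rfl, hfree⟩
    obtain ⟨v, hv, ψ, hψ, hext⟩ := h.exists_extension hD hP hΔ hcard hU (not_lt.mp hfree)
    have hinsert := Finset.card_insert_of_notMem hv
    have huniv := Finset.card_le_univ (insert v S)
    obtain ⟨T, ψ', hT, himage, hTfree⟩ := ih _ (by omega) hψ rfl
    refine ⟨T, ψ', hT, Finset.Subset.trans ?_ himage, hTfree⟩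
    rw [← Finset.image_congr hext]
    exact Finset.image_subset_image (Finset.subset_insert v S)

theorem exists_isPartialEmbedding [DecidableEq V] (φ₀ : W → V) {x y P : ℕ} {Δ : ℕ → ℕ}
    (hD : Pairwise (Function.onFun Disjoint D)) (hP : ∀ j, ∀ v ∈ D j, H.degree v ≤ P)
    (hΔ : ∀ g < G, ∀ v ∈ D g, H.degree v ≤ Δ g)
    (hcard : ∀ g < G, (B g).card + x * (P * P + 1) ≤ (D g).card)
    (hU : ∀ g < G,
      IsExpanding U.edgeSet ((Finset.range (g + 1)).biUnion B) (B g) x y (Δ g)) :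
    ∃ S φ, IsPartialEmbedding H U D B G S φ ∧ ∀ g < G, (B g \ S.image φ).card < y := by
  induction G with
  | zero => exact ⟨∅, φ₀, ⟨by simp, by simp, by simp⟩, by simp⟩
  | succ g ih =>
    obtain ⟨S, φ, hS, hfree⟩ := ih (fun j hj => hΔ j (hj.trans g.lt_succ_self))
      (fun j hj => hcard j (hj.trans g.lt_succ_self)) (fun j hj => hU j (hj.trans g.lt_succ_self))
    obtain ⟨T, ψ, hT, himage, hTfree⟩ := (hS.mono g.le_succ).exists_fill_level hD hP
      (hΔ g g.lt_succ_self) (hcard g g.lt_succ_self) (hU g g.lt_succ_self)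
    refine ⟨T, ψ, hT, fun j hj => ?_⟩
    rcases (Nat.lt_succ_iff.mp hj).lt_or_eq with hjg | rfl
    · exact (Finset.card_le_card (Finset.sdiff_subset_sdiff subset_rfl himage)).trans_lt
        (hfree j hjg)
    · exact hTfree

omit [DecidableRel H.Adj]

theorem exists_equiv_eqOn_of_card_le [Fintype V] [DecidableEq V] {I : Finset W} {A : Finset V}
    (hVW : Fintype.card W = Fintype.card V) (hφ : Set.InjOn φ S) (hSI : Disjoint S I)
    (hI : ((A ∪ S.image φ)ᶜ).card ≤ I.card) :
    ∃ σ : W ≃ V, Set.EqOn σ φ S ∧ ∀ w, w ∉ S → w ∉ I → σ w ∈ A := by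
  classical
  rcases isEmpty_or_nonempty W with hW | hW
  · exact ⟨Fintype.equivOfCardEq hVW, fun w => hW.elim w, fun w => hW.elim w⟩
  have : Nonempty V := hW.map φ
  obtain ⟨I', hI', hcard⟩ := Finset.exists_subset_card_eq hI
  obtain ⟨f, hf⟩ : ∃ f : W → V, Set.BijOn f I' ((A ∪ S.image φ)ᶜ : Finset V) :=
    I'.finite_toSet.exists_bijOn_of_encard_eq (by
      rw [Set.encard_coe_eq_coe_finsetCard, Set.encard_coe_eq_coe_finsetCard, hcard])
  let ψ : W → V := (I' : Set W).piecewise f φ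
  have hψI : Set.BijOn ψ I' ((A ∪ S.image φ)ᶜ : Finset V) :=
    hf.congr (Set.piecewise_eqOn _ _ _).symm
  have hψS : Set.EqOn ψ φ S := fun w hw => Set.piecewise_eq_of_notMem _ _ _
    fun hwI => Finset.disjoint_left.mp hSI hw (hI' hwI)
  have hψ : Set.InjOn ψ ↑(I' ∪ S) := by
    rw [Finset.coe_union, Set.injOn_union
      (Finset.disjoint_coe.mpr (Finset.disjoint_of_subset_left hI' hSI.symm))]
    refine ⟨hψI.injOn, hφ.congr hψS.symm, fun v hv w hw hvw => ?_⟩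
    refine Finset.mem_compl.mp (hψI.mapsTo hv) (Finset.mem_union_right _ ?_)
    rw [hvw, hψS hw]
    exact Finset.mem_image_of_mem φ hw
  obtain ⟨g, hg⟩ := Finset.exists_equiv_extend_of_card_eq (hVW.trans Finset.card_univ.symm)
    (Finset.subset_univ _) hψ
  let σ : W ≃ V := g.trans (Equiv.subtypeUnivEquiv Finset.mem_univ)
  have hσ : ∀ w ∈ I' ∪ S, σ w = ψ w := hg
  refine ⟨σ, fun w hw => (hσ w (Finset.mem_union_right _ hw)).trans (hψS hw),
    fun w hwS hwI => by_contra fun hwA => ?_⟩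
  obtain ⟨u, hu, huw⟩ : ∃ u ∈ I' ∪ S, ψ u = σ w := by
    by_cases hwφ : σ w ∈ S.image φ
    · obtain ⟨u, hu, huw⟩ := Finset.mem_image.mp hwφ
      exact ⟨u, Finset.mem_union_right _ hu, (hψS hu).trans huw⟩
    · obtain ⟨u, hu, huw⟩ := hψI.surjOn
        (Finset.mem_compl.mpr fun h => (Finset.mem_union.mp h).elim hwA hwφ)
      exact ⟨u, Finset.mem_union_left _ hu, huw⟩
  obtain rfl : u = w := σ.injective ((hσ u hu).trans huw)
  exact (Finset.mem_union.mp hu).elim (fun h => hwI (hI' h)) hwS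

theorem IsPartialEmbedding.isContained [Fintype V] [DecidableEq V] {I : Finset W} {A : Finset V}
    (h : IsPartialEmbedding H U D B G S φ) (hgroup : IsVertexGrouping H I D)
    (hVW : Fintype.card W = Fintype.card V) (hA : ∀ a ∈ A, ∀ b, b ≠ a → U.Adj a b)
    (hI : ((A ∪ S.image φ)ᶜ).card ≤ I.card) : H ⊑ U := by
  have hSI : Disjoint S I := Finset.disjoint_left.mpr fun w hwS hwI => by
    obtain ⟨j, -, hwj, -⟩ := h.mem w hwS
    exact Finset.disjoint_left.mp (hgroup.disjoint j) hwI hwj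
  obtain ⟨σ, hσ, hσA⟩ := exists_equiv_eqOn_of_card_le hVW h.injOn hSI hI
  have hmemS : ∀ a b, H.Adj a b → σ a ∉ A → σ b ∉ A → a ∈ S := fun a b hab ha hb => by
    by_contra haS
    obtain ⟨hbI, hbD⟩ := hgroup.notMem_of_adj a (by_contra fun haI => ha (hσA a haS haI)) b hab
    refine hb (hσA b (fun hbS => ?_) hbI)
    obtain ⟨j, -, hbj, -⟩ := h.mem b hbS
    exact hbD j hbj
  refine isContained_iff_exists_le_comap.mpr ⟨σ.toEmbedding, fun a b hab => ?_⟩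
  change U.Adj (σ a) (σ b)
  by_cases ha : σ a ∈ A
  · exact hA _ ha _ (σ.injective.ne hab.ne')
  by_cases hb : σ b ∈ A
  · exact (hA _ hb _ (σ.injective.ne hab.ne)).symm
  have haS := hmemS a b hab ha hb
  have hbS := hmemS b a hab.symm hb ha
  rw [hσ haS, hσ hbS]
  exact h.adj a haS b hbS hab

theorem IsVertexGrouping.isContained [Fintype V] [DecidableEq V] [DecidableRel H.Adj]
    {I : Finset W} {A : Finset V} {x y P : ℕ} {Δ : ℕ → ℕ} (hgroup : IsVertexGrouping H I D)
    (hVW : Fintype.card W = Fintype.card V) (hA : ∀ a ∈ A, ∀ b, b ≠ a → U.Adj a b)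
    (hcover : ∀ v, v ∈ A ∨ ∃ g < G, v ∈ B g) (hI : G * y ≤ I.card)
    (hP : ∀ j, ∀ v ∈ D j, H.degree v ≤ P) (hΔ : ∀ g < G, ∀ v ∈ D g, H.degree v ≤ Δ g)
    (hcard : ∀ g < G, (B g).card + x * (P * P + 1) ≤ (D g).card)
    (hU : ∀ g < G,
      IsExpanding U.edgeSet ((Finset.range (g + 1)).biUnion B) (B g) x y (Δ g)) : H ⊑ U := by
  obtain ⟨S, φ, hS, hfree⟩ := exists_isPartialEmbedding (Fintype.equivOfCardEq hVW)
    hgroup.pairwise_disjoint hP hΔ hcard hU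
  have hsub : (A ∪ S.image φ)ᶜ ⊆ (Finset.range G).biUnion fun j => B j \ S.image φ := by
    intro v hv
    rw [Finset.mem_compl, Finset.mem_union, not_or] at hv
    obtain ⟨g, hg, hvg⟩ := (hcover v).resolve_left hv.1
    exact Finset.mem_biUnion.mpr
      ⟨g, Finset.mem_range.mpr hg, Finset.mem_sdiff.mpr ⟨hvg, hv.2⟩⟩
  refine hS.isContained hgroup hVW hA ((Finset.card_le_card hsub).trans ?_)
  refine (Finset.card_biUnion_le_card_mul _ _ y
    fun j hj => (hfree j (Finset.mem_range.mp hj)).le).trans ?_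
  rwa [Finset.card_range]

end Embedding

theorem exists_monotone_top_subsets {α : Type*} (s : Finset α) (f : α → ℕ) :
    ∃ T : ℕ → Finset α, Monotone T ∧ (∀ k, T k ⊆ s) ∧ (∀ k, (T k).card = min k s.card) ∧
      ∀ k, ∀ v ∈ s, v ∉ T k → ∀ u ∈ T k, f v ≤ f u := by
  classical
  induction s using Finset.induction_on_min_value f with
  | empty => exact ⟨fun _ => ∅, monotone_const, by simp⟩
  | insert a s ha hmin ih =>
    obtain ⟨T, hmono, hsub, hcard, htop⟩ := ih
    refine ⟨fun k => if k ≤ s.card then T k else insert a s, ?_, fun k => ?_, fun k => ?_,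
      fun k v hv hvk u hu => ?_⟩
    · intro k l hkl
      rcases le_or_gt l s.card with hl | hl
      · simpa only [hkl.trans hl, hl, if_true] using hmono hkl
      · simp only [hl.not_ge, if_false]
        split_ifs
        exacts [(hsub k).trans (Finset.subset_insert a s), subset_rfl]
    · beta_reduce
      split_ifs
      exacts [(hsub k).trans (Finset.subset_insert a s), subset_rfl]
    · beta_reduce
      rw [Finset.card_insert_of_notMem ha]
      split_ifs with hk
      · rw [hcard, min_eq_left hk, min_eq_left (hk.trans s.card.le_succ)]
      · rw [Finset.card_insert_of_notMem ha, min_eq_right (not_le.mp hk)]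
    · beta_reduce at hvk hu
      split_ifs at hvk hu with hk
      · rcases Finset.mem_insert.mp hv with rfl | hvs
        · exact hmin u (hsub k hu)
        · exact htop k v hvs hvk u hu
      · exact absurd hv hvk

section VertexGrouping

variable {W : Type*} [Fintype W] (H : SimpleGraph W) [DecidableRel H.Adj]

theorem sum_degree_eq_two_mul_numEdges : ∑ v, H.degree v = 2 * numEdges H := by
  rw [sum_degrees_eq_twice_card_edges, numEdges_eq_card]

theorem card_filter_lt_degree_mul_le (d : ℕ) :
    (Finset.univ.filter fun v => d < H.degree v).card * (d + 1) ≤ 2 * numEdges H := by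
  rw [← sum_degree_eq_two_mul_numEdges]
  exact (Finset.card_nsmul_le_sum _ _ (d + 1) fun v hv => (Finset.mem_filter.mp hv).2).trans
    (Finset.sum_le_sum_of_subset (Finset.filter_subset _ _))

theorem exists_independent_card_closedNeighbors_le [DecidableEq W] {w d : ℕ}
    (hd : 4 * numEdges H ≤ d * Fintype.card W) (hw : 2 * (w * (d + 1)) ≤ Fintype.card W) :
    ∃ I : Finset W, I.card = w ∧ (I : Set W).Pairwise (fun u v => ¬ H.Adj u v) ∧
      (I ∪ I.biUnion fun v => H.neighborFinset v).card ≤ w * (d + 1) := by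
  let X : Finset W := Finset.univ.filter fun v => ¬ d < H.degree v
  have hXd : ∀ v ∈ X, H.degree v ≤ d := fun v hv => not_lt.mp (Finset.mem_filter.mp hv).2
  have hhigh : 2 * (Finset.univ.filter fun v => d < H.degree v).card ≤ Fintype.card W := by
    have := card_filter_lt_degree_mul_le H d
    nlinarith
  have hX : w * (d + 1) ≤ X.card := by
    have : _ + X.card = Fintype.card W :=
      Finset.card_filter_add_card_filter_not (s := Finset.univ) fun v => d < H.degree v
    omega
  obtain ⟨I, hIX, hI, hindep⟩ := exists_independent_subset H.symm w X
    (fun v hv => (Finset.card_le_card fun u hu => by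
      rw [mem_neighborFinset]
      exact (Finset.mem_filter.mp hu).2).trans (hXd v hv)) hX
  refine ⟨I, hI, hindep, ?_⟩
  calc (I ∪ I.biUnion fun v => H.neighborFinset v).card
      ≤ I.card + I.card * d := (Finset.card_union_le _ _).trans (Nat.add_le_add_left
        (Finset.card_biUnion_le_card_mul _ _ _ fun v hv => hXd v (hIX hv)) _)
    _ = w * (d + 1) := by rw [hI, mul_add_one, add_comm]

theorem exists_isVertexGrouping {w d τ M G : ℕ} {b : ℕ → ℕ}
    (hd : 4 * numEdges H ≤ d * Fintype.card W) (hw : 2 * (w * (d + 1)) ≤ Fintype.card W)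
    (hsum : τ + ∑ g ∈ Finset.range G, (b g + M) + w * (d + 1) ≤ Fintype.card W) :
    ∃ (I : Finset W) (D : ℕ → Finset W), IsVertexGrouping H I D ∧ I.card = w ∧
      (∀ g < G, (D g).card = b g + M) ∧
      ∀ j, ∀ v ∈ D j, H.degree v * (τ + ∑ i ∈ Finset.range j, b i) ≤ 2 * numEdges H := by
  classical
  obtain ⟨I, hI, hindep, hK⟩ := exists_independent_card_closedNeighbors_le H hd hw
  set K := I ∪ I.biUnion fun v => H.neighborFinset v
  obtain ⟨T, hmono, hsub, hcard, htop⟩ := exists_monotone_top_subsets Kᶜ fun v => H.degree v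
  let c : ℕ → ℕ := fun j => τ + ∑ i ∈ Finset.range j, (b i + M)
  have hc : ∀ j, c (j + 1) = c j + (b j + M) := fun j => by
    simp only [c, Finset.sum_range_succ, add_assoc]
  have hcmono : Monotone c := monotone_nat_of_le_succ fun j => (Nat.le_add_right _ _).trans_eq
    (hc j).symm
  have hDK : ∀ j, ∀ v ∈ T (c (j + 1)) \ T (c j), v ∉ K := fun j v hv =>
    Finset.mem_compl.mp (hsub _ (Finset.mem_sdiff.mp hv).1)
  refine ⟨I, fun j => T (c (j + 1)) \ T (c j), ⟨?_, fun j => ?_, fun v hv w hvw => ⟨fun hw => ?_,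
    fun j hj => hDK j w hj ?_⟩⟩, hI, fun g hg => ?_, fun j v hv => ?_⟩
  · exact (pairwise_disjoint_on _).mpr fun i j hij => Finset.disjoint_of_subset_left
      (Finset.sdiff_subset.trans (hmono (hcmono hij))) Finset.disjoint_sdiff
  · exact Finset.disjoint_left.mpr fun v hv hvj => hDK j v hvj (Finset.mem_union_left _ hv)
  · exact hindep hv hw hvw.ne hvw
  · exact Finset.mem_union_right _
      (Finset.mem_biUnion.mpr ⟨v, hv, (mem_neighborFinset _ _ _).mpr hvw⟩)
  · have hle : c (g + 1) ≤ Kᶜ.card := by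
      have : c G + w * (d + 1) ≤ Fintype.card W := hsum
      have : c (g + 1) ≤ c G := hcmono hg
      rw [Finset.card_compl]
      omega
    rw [Finset.card_sdiff_of_subset (hmono (hcmono g.le_succ)), hcard, hcard, min_eq_left hle,
      min_eq_left ((hcmono g.le_succ).trans hle), hc, Nat.add_sub_cancel_left]
  · obtain ⟨hvT, hv⟩ := Finset.mem_sdiff.mp hv
    have hlt : (T (c j)).card < Kᶜ.card := Finset.card_lt_card
      ⟨hsub _, fun h => hv (h (hsub _ hvT))⟩
    calc H.degree v * (τ + ∑ i ∈ Finset.range j, b i) ≤ H.degree v * (T (c j)).card := by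
          refine Nat.mul_le_mul_left _ ?_
          rw [hcard] at hlt ⊢
          rw [min_eq_left (min_lt_iff.mp hlt |>.resolve_right (lt_irrefl _)).le]
          exact Nat.add_le_add_left (Finset.sum_le_sum fun i _ => Nat.le_add_right _ _) _
      _ ≤ ∑ u ∈ T (c j), H.degree u := by
          rw [mul_comm]
          exact Finset.card_nsmul_le_sum _ _ _ (htop _ v (hsub _ hvT) hv)
      _ ≤ ∑ u, H.degree u := Finset.sum_le_sum_of_subset (Finset.subset_univ _)
      _ = 2 * numEdges H := sum_degree_eq_two_mul_numEdges H

end VertexGrouping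

theorem isUniversal_of_isExpanding {V : Type*} [Fintype V] [DecidableEq V] {U : SimpleGraph V}
    {A : Finset V} {B : ℕ → Finset V} {n m x y P G τ d : ℕ} {Δ : ℕ → ℕ}
    (hn : Fintype.card V = n)
    (hA : ∀ a ∈ A, ∀ b, b ≠ a → U.Adj a b) (hcover : ∀ v, v ∈ A ∨ ∃ g < G, v ∈ B g)
    (hd : 4 * m ≤ d * n) (hw : 2 * (G * y * (d + 1)) ≤ n)
    (hsum : τ + ∑ g ∈ Finset.range G, ((B g).card + x * (P * P + 1)) + G * y * (d + 1) ≤ n)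
    (hP : 2 * m < (P + 1) * τ)
    (hΔ : ∀ g < G, 2 * m < (Δ g + 1) * (τ + ∑ i ∈ Finset.range g, (B i).card))
    (hU : ∀ g < G,
      IsExpanding U.edgeSet ((Finset.range (g + 1)).biUnion B) (B g) x y (Δ g)) :
    IsUniversal n m U := by
  classical
  rintro H rfl
  obtain ⟨I, D, hgroup, hI, hDcard, hdeg⟩ := exists_isVertexGrouping H (by rwa [Fintype.card_fin])
    (by rwa [Fintype.card_fin]) (by rwa [Fintype.card_fin])
  refine hgroup.isContained (P := P) (Fintype.card_fin n |>.trans hn.symm) hA hcover hI.ge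
    (fun j v hv => ?_) (fun g hg v hv => ?_) (fun g hg => (hDcard g hg).ge) hU
  · refine Nat.lt_succ_iff.mp (lt_of_mul_lt_mul_right' ?_ (a := τ))
    exact ((Nat.mul_le_mul_left _ (Nat.le_add_right _ _)).trans (hdeg j v hv)).trans_lt hP
  · exact Nat.lt_succ_iff.mp (lt_of_mul_lt_mul_right' ((hdeg g v hv).trans_lt (hΔ g hg)))

section Coloring

variable {E κ : Type*} [Fintype E] [Fintype κ] [DecidableEq κ]

theorem sum_prod_indicator_eq [DecidableEq E] [Nonempty κ] (S : Finset κ) (M : Finset E) :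
    ∑ c : E → κ, ∏ e ∈ M, (if c e ∈ S then (1 : ℝ) else 0) =
      (Fintype.card κ : ℝ) ^ Fintype.card E * ((S.card : ℝ) / Fintype.card κ) ^ M.card := by
  have hextend : ∀ c : E → κ, ∏ e ∈ M, (if c e ∈ S then (1 : ℝ) else 0) =
      ∏ e, (if e ∈ M then (if c e ∈ S then (1 : ℝ) else 0) else 1) := fun c => by
    rw [Finset.prod_ite_mem, Finset.univ_inter]
  have hcolor : ∀ e : E, ∑ a : κ, (if e ∈ M then (if a ∈ S then (1 : ℝ) else 0) else 1) =
      Fintype.card κ * (if e ∈ M then (S.card : ℝ) / Fintype.card κ else 1) := fun e => by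
    split_ifs
    · rw [Finset.sum_boole, Finset.filter_univ_mem, mul_div_cancel₀ _ (by positivity)]
    · simp
  simp_rw [hextend]
  rw [← Fintype.piFinset_univ, ← Finset.prod_univ_sum (fun _ => Finset.univ)
    (fun e a => if e ∈ M then (if a ∈ S then (1 : ℝ) else 0) else 1)]
  simp_rw [hcolor]
  rw [Finset.prod_mul_distrib, Finset.prod_ite_mem, Finset.prod_const, Finset.prod_const,
    Finset.univ_inter, Finset.card_univ]

theorem card_filter_forall_exists_notMem [DecidableEq E] [Nonempty κ] {J : Type*} [Fintype J]
    (T : J → Finset E) (hT : Pairwise (Function.onFun Disjoint T)) (S : Finset κ) :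
    ((Finset.univ.filter fun c : E → κ => ∀ j, ∃ e ∈ T j, c e ∉ S).card : ℝ) =
      (Fintype.card κ : ℝ) ^ Fintype.card E *
        ∏ j, (1 + -((S.card : ℝ) / Fintype.card κ) ^ (T j).card) := by
  classical
  have hindicator : ∀ c : E → κ, (if ∀ j, ∃ e ∈ T j, c e ∉ S then (1 : ℝ) else 0) =
      ∏ j, (1 + -∏ e ∈ T j, (if c e ∈ S then (1 : ℝ) else 0)) := by
    intro c
    split_ifs with h
    · refine (Finset.prod_eq_one fun j _ => ?_).symm
      obtain ⟨e, he, hce⟩ := h j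
      rw [Finset.prod_eq_zero he (if_neg hce), neg_zero, add_zero]
    · push Not at h
      obtain ⟨j, hj⟩ := h
      refine (Finset.prod_eq_zero (Finset.mem_univ j) ?_).symm
      rw [Finset.prod_eq_one fun e he => if_pos (hj e he), add_neg_cancel]
  have hexpand : ∀ K : Finset J, ∑ c : E → κ,
      ∏ j ∈ K, -∏ e ∈ T j, (if c e ∈ S then (1 : ℝ) else 0) =
        (Fintype.card κ : ℝ) ^ Fintype.card E *
          ∏ j ∈ K, -((S.card : ℝ) / Fintype.card κ) ^ (T j).card := by
    intro K
    have hdisj : (K : Set J).PairwiseDisjoint T := hT.set_pairwise _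
    simp_rw [Finset.prod_neg]
    rw [← Finset.mul_sum]
    simp_rw [← Finset.prod_biUnion hdisj]
    rw [sum_prod_indicator_eq, Finset.card_biUnion hdisj, Finset.prod_pow_eq_pow_sum]
    ring
  rw [Finset.card_filter, Nat.cast_sum]
  simp_rw [Nat.cast_ite, Nat.cast_one, Nat.cast_zero, hindicator, Finset.prod_one_add]
  rw [Finset.sum_comm, Finset.mul_sum]
  exact Finset.sum_congr rfl fun K _ => hexpand K

theorem card_filter_forall_exists_notMem_le [DecidableEq E] [Nonempty κ] {J : Type*} [Fintype J]
    (T : J → Finset E) (hT : Pairwise (Function.onFun Disjoint T)) (S : Finset κ) {t : ℕ}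
    (ht : ∀ j, (T j).card ≤ t) {p : ℝ} (hp : 0 ≤ p) (hS : p ≤ S.card / Fintype.card κ) :
    ((Finset.univ.filter fun c : E → κ => ∀ j, ∃ e ∈ T j, c e ∉ S).card : ℝ) ≤
      (Fintype.card κ : ℝ) ^ Fintype.card E * (1 - p ^ t) ^ Fintype.card J := by
  have hS1 : (S.card : ℝ) / Fintype.card κ ≤ 1 :=
    div_le_one_of_le₀ (Nat.cast_le.mpr (Finset.card_le_univ S)) (Nat.cast_nonneg _)
  rw [card_filter_forall_exists_notMem T hT, ← Finset.card_univ (α := J), ← Finset.prod_const]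
  refine mul_le_mul_of_nonneg_left (Finset.prod_le_prod (fun j _ => ?_) fun j _ => ?_)
    (by positivity)
  · have := pow_le_one₀ (n := (T j).card) (by positivity) hS1
    linarith
  · have := pow_le_pow_of_le_one hp (hS.trans hS1) (ht j)
    have := pow_le_pow_left₀ hp hS (T j).card
    linarith

theorem card_filter_card_le (V : Type*) [Fintype V] (d : ℕ) :
    (Finset.univ.filter fun N : Finset V => N.card ≤ d).card ≤ (Fintype.card V + 1) ^ d := by
  classical
  induction d with
  | zero => simp [Finset.filter_eq']
  | succ d ih =>
    let S : Finset (Finset V) := Finset.univ.filter fun N => N.card ≤ d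
    let extend : Option V × Finset V → Finset V := fun p => p.1.elim p.2 fun v => insert v p.2
    have hsub : (Finset.univ.filter fun N : Finset V => N.card ≤ d + 1) ⊆
        ((Finset.univ : Finset (Option V)) ×ˢ S).image extend := by
      intro N hN
      have hNd := (Finset.mem_filter.mp hN).2
      rcases N.eq_empty_or_nonempty with rfl | ⟨v, hv⟩
      · exact Finset.mem_image.mpr ⟨(none, ∅), by simp [S], rfl⟩
      · refine Finset.mem_image.mpr ⟨(some v, N.erase v), ?_, Finset.insert_erase hv⟩
        have := Finset.card_erase_of_mem hv
        simp only [S, Finset.mem_product, Finset.mem_univ, Finset.mem_filter, true_and]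
        omega
    calc _ ≤ (((Finset.univ : Finset (Option V)) ×ˢ S).image extend).card :=
          Finset.card_le_card hsub
      _ ≤ (Fintype.card V + 1) * S.card := by
          refine Finset.card_image_le.trans_eq ?_
          rw [Finset.card_product, Finset.card_univ, Fintype.card_option]
      _ ≤ (Fintype.card V + 1) ^ (d + 1) := by
          rw [pow_succ']
          exact Nat.mul_le_mul_left _ ih

theorem card_piFinset_product_powersetCard_le (V : Type*) [Fintype V] (x y d : ℕ) :
    ((Fintype.piFinset fun _ : Fin x => Finset.univ.filter fun N : Finset V => N.card ≤ d) ×ˢ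
      Finset.powersetCard y (Finset.univ : Finset V)).card ≤
        (Fintype.card V + 1) ^ (d * x) * Fintype.card V ^ y := by
  rw [Finset.card_product, Fintype.card_piFinset_const, Finset.card_powersetCard,
    Finset.card_univ, pow_mul]
  exact Nat.mul_le_mul (Nat.pow_le_pow_left (card_filter_card_le V d) x) (Nat.choose_le_pow _ _)

end Coloring

theorem exists_forall_notMem_of_card_mul_lt_one {Ω α : Type*} [Fintype Ω] [Nonempty Ω]
    (s : Finset α) (bad : α → Finset Ω) {r : ℝ}
    (hbad : ∀ a ∈ s, ((bad a).card : ℝ) ≤ Fintype.card Ω * r) (hr : s.card * r < 1) :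
    ∃ c, ∀ a ∈ s, c ∉ bad a := by
  classical
  by_contra! hcover
  have hunion : (Fintype.card Ω : ℝ) ≤ Fintype.card Ω * (s.card * r) := by
    calc (Fintype.card Ω : ℝ) ≤ ∑ a ∈ s, ((bad a).card : ℝ) := by
          rw [← Finset.card_univ]
          exact_mod_cast (Finset.card_le_card fun c _ => Finset.mem_biUnion.mpr (hcover c)).trans
            Finset.card_biUnion_le
      _ ≤ s.card * (Fintype.card Ω * r) := by
          rw [← nsmul_eq_mul]
          exact Finset.sum_le_card_nsmul _ _ _ hbad
      _ = Fintype.card Ω * (s.card * r) := by ring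
  exact hunion.not_gt (mul_lt_of_lt_one_right (Nat.cast_pos.mpr Fintype.card_pos) hr)

section ExpandingColoring

variable {V κ : Type*} [Fintype V] [DecidableEq V] [Fintype κ] [DecidableEq κ]

theorem card_filter_forall_exists_color_notMem_le [Nonempty κ] {x Δ : ℕ} {N : Fin x → Finset V}
    {Y : Finset V} (hN : Pairwise (Function.onFun Disjoint N)) (hNΔ : ∀ i, (N i).card ≤ Δ)
    (hNY : ∀ i, Disjoint (N i) Y) (S : Finset κ) {p : ℝ} (hp : 0 ≤ p)
    (hS : p ≤ S.card / Fintype.card κ) :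
    ((Finset.univ.filter fun c : Sym2 V → κ =>
      ∀ i, ∀ b ∈ Y, ∃ u ∈ N i, c s(u, b) ∉ S).card : ℝ) ≤
        (Fintype.card κ : ℝ) ^ Fintype.card (Sym2 V) * (1 - p ^ Δ) ^ (x * Y.card) := by
  let T : Fin x × Y → Finset (Sym2 V) := fun j => (N j.1).image fun u => s(u, j.2)
  have hT : Pairwise (Function.onFun Disjoint T) := by
    refine fun j k hjk => Finset.disjoint_left.mpr fun e hj hk => ?_
    obtain ⟨u, hu, rfl⟩ := Finset.mem_image.mp hj
    obtain ⟨u', hu', heq⟩ := Finset.mem_image.mp hk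
    rcases Sym2.eq_iff.mp heq with ⟨rfl, hb⟩ | ⟨rfl, -⟩
    · refine hjk (Prod.ext ?_ (Subtype.ext hb.symm))
      by_contra hne
      exact Finset.disjoint_left.mp (hN hne) hu hu'
    · exact Finset.disjoint_left.mp (hNY _) hu' j.2.2
  have hcount := card_filter_forall_exists_notMem_le T hT S
    (fun j => Finset.card_image_le.trans (hNΔ j.1)) hp hS
  rw [Fintype.card_prod, Fintype.card_fin, Fintype.card_coe] at hcount
  refine le_trans (Nat.cast_le.mpr (Finset.card_le_card fun c hc => ?_)) hcount
  refine Finset.mem_filter.mpr ⟨Finset.mem_univ _, fun j => ?_⟩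
  obtain ⟨u, hu, hcu⟩ := (Finset.mem_filter.mp hc).2 j.1 j.2 j.2.2
  exact ⟨_, Finset.mem_image_of_mem _ hu, hcu⟩

omit [DecidableEq V] [DecidableEq κ] in
theorem exists_coloring_isExpanding_of_count [Nonempty κ] {ι : Type*} [Fintype ι] {x y Δ : ℕ}
    (S : ι → Finset κ) {p : ℝ} (hp : 0 ≤ p) (hp1 : p ≤ 1)
    (hS : ∀ a, p ≤ (S a).card / Fintype.card κ)
    (hlt : Fintype.card ι * ((Fintype.card V + 1 : ℝ) ^ (Δ * x) * (Fintype.card V : ℝ) ^ y) *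
      (1 - p ^ Δ) ^ (x * y) < 1) :
    ∃ c : Sym2 V → κ, ∀ a, IsExpanding {e | c e ∈ S a} Finset.univ Finset.univ x y Δ := by
  classical
  let codes : Finset (ι × (Fin x → Finset V) × Finset V) := Finset.univ ×ˢ
    (Fintype.piFinset fun _ => Finset.univ.filter fun N : Finset V => N.card ≤ Δ) ×ˢ
      Finset.powersetCard y Finset.univ
  have hmem : ∀ a N Y, (a, N, Y) ∈ codes ↔ (∀ i, (N i).card ≤ Δ) ∧ Y.card = y := fun a N Y => by
    simp only [codes, Finset.mem_product, Fintype.mem_piFinset, Finset.mem_filter,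
      Finset.mem_univ, true_and, Finset.mem_powersetCard_univ]
  let valid := codes.filter fun q =>
    Pairwise (Function.onFun Disjoint q.2.1) ∧ ∀ i, Disjoint (q.2.1 i) q.2.2
  let bad : ι × (Fin x → Finset V) × Finset V → Finset (Sym2 V → κ) := fun q =>
    Finset.univ.filter fun c => ∀ i, ∀ b ∈ q.2.2, ∃ u ∈ q.2.1 i, c s(u, b) ∉ S q.1
  have hbad : ∀ q ∈ valid,
      ((bad q).card : ℝ) ≤ Fintype.card (Sym2 V → κ) * (1 - p ^ Δ) ^ (x * y) := by
    rintro ⟨a, N, Y⟩ hq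
    obtain ⟨hq, hN, hNY⟩ := Finset.mem_filter.mp hq
    obtain ⟨hNΔ, hY⟩ := (hmem a N Y).mp hq
    rw [← hY, Fintype.card_fun, Nat.cast_pow]
    exact card_filter_forall_exists_color_notMem_le hN hNΔ hNY (S a) hp (hS a)
  have hcodes : valid.card ≤
      Fintype.card ι * ((Fintype.card V + 1) ^ (Δ * x) * Fintype.card V ^ y) := by
    refine (Finset.card_le_card (Finset.filter_subset _ _)).trans ?_
    rw [Finset.card_product, Finset.card_univ]
    exact Nat.mul_le_mul_left _ (card_piFinset_product_powersetCard_le V x y Δ)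
  have hr : 0 ≤ (1 - p ^ Δ) ^ (x * y) := pow_nonneg (sub_nonneg.mpr (pow_le_one₀ hp hp1)) _
  obtain ⟨c, hc⟩ := exists_forall_notMem_of_card_mul_lt_one valid bad hbad
    ((mul_le_mul_of_nonneg_right (by exact_mod_cast hcodes) hr).trans_lt hlt)
  refine ⟨c, fun a N Y hN _ hNΔ _ hY hNY => by_contra fun hNo => ?_⟩
  push Not at hNo
  exact hc (a, N, Y) (Finset.mem_filter.mpr ⟨(hmem a N Y).mpr ⟨hNΔ, hY⟩, hN, hNY⟩)
    (Finset.mem_filter.mpr ⟨Finset.mem_univ c, hNo⟩)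

end ExpandingColoring

theorem mul_one_sub_pow_lt_one_of_log_lt {q v p : ℝ} {x y Δ : ℕ} (hv : 0 ≤ v) (hp : 0 ≤ p)
    (hp1 : p ≤ 1)
    (h : Real.log q + (Δ * x + y) * Real.log (v + 1) < p ^ Δ * (x * y)) :
    q * ((v + 1) ^ (Δ * x) * v ^ y) * (1 - p ^ Δ) ^ (x * y) < 1 := by
  have hdecay : (1 - p ^ Δ) ^ (x * y) ≤ Real.exp (-(p ^ Δ * (x * y))) := by
    calc (1 - p ^ Δ) ^ (x * y) ≤ Real.exp (-p ^ Δ) ^ (x * y) :=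
          pow_le_pow_left₀ (sub_nonneg.mpr (pow_le_one₀ hp hp1)) (Real.one_sub_le_exp_neg _) _
      _ = Real.exp (-(p ^ Δ * (x * y))) := by
          rw [← Real.exp_nat_mul]
          push_cast
          ring_nf
  have hcodes : (v + 1) ^ (Δ * x) * v ^ y ≤ Real.exp ((Δ * x + y) * Real.log (v + 1)) := by
    calc (v + 1) ^ (Δ * x) * v ^ y ≤ (v + 1) ^ (Δ * x) * (v + 1) ^ y := by
          gcongr
          linarith
      _ = Real.exp (Real.log (v + 1)) ^ (Δ * x + y) := by
          rw [Real.exp_log (by positivity), pow_add]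
      _ = Real.exp ((Δ * x + y) * Real.log (v + 1)) := by
          rw [← Real.exp_nat_mul]
          push_cast
          ring_nf
  have hdecay0 : 0 ≤ (1 - p ^ Δ) ^ (x * y) :=
    pow_nonneg (sub_nonneg.mpr (pow_le_one₀ hp hp1)) _
  calc q * ((v + 1) ^ (Δ * x) * v ^ y) * (1 - p ^ Δ) ^ (x * y)
      ≤ Real.exp (Real.log q) * Real.exp ((Δ * x + y) * Real.log (v + 1)) *
        Real.exp (-(p ^ Δ * (x * y))) := by
        gcongr
        exact Real.le_exp_log q
    _ = Real.exp (Real.log q + (Δ * x + y) * Real.log (v + 1) - p ^ Δ * (x * y)) := by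
        rw [← Real.exp_add, ← Real.exp_add, sub_eq_add_neg]
    _ < 1 := Real.exp_lt_one_iff.mpr (by linarith)

theorem exists_coloring_isExpanding {V κ ι : Type*} [Fintype V] [Fintype κ] [Nonempty κ]
    [Fintype ι] {x y Δ : ℕ} (S : ι → Finset κ) {p : ℝ} (hp : 0 ≤ p) (hp1 : p ≤ 1)
    (hS : ∀ a, p ≤ (S a).card / Fintype.card κ)
    (hlog : Real.log (Fintype.card ι) + (Δ * x + y) * Real.log (Fintype.card V + 1) <
      p ^ Δ * (x * y)) :
    ∃ c : Sym2 V → κ, ∀ a, IsExpanding {e | c e ∈ S a} Finset.univ Finset.univ x y Δ :=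
  exists_coloring_isExpanding_of_count S hp hp1 hS
    (mul_one_sub_pow_lt_one_of_log_lt (Nat.cast_nonneg _) hp hp1 hlog)

section ColourClasses

variable {V : Type*} [Fintype V] {x y Δ Q : ℕ}

open Classical in
theorem exists_isExpanding_card_filter_mem_le (hQ : 0 < Q) (E : Finset (Sym2 V))
    (hlog : Real.log Q + (Δ * x + y) * Real.log (Fintype.card V + 1) <
      (1 / (Q : ℝ)) ^ Δ * (x * y)) :
    ∃ R : Set (Sym2 V), IsExpanding R Finset.univ Finset.univ x y Δ ∧
      ((E.filter (· ∈ R)).card : ℝ) ≤ E.card / Q := by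
  have : NeZero Q := ⟨hQ.ne'⟩
  have hQ1 : (1 : ℝ) ≤ Q := Nat.one_le_cast.mpr hQ
  obtain ⟨c, hc⟩ := exists_coloring_isExpanding (V := V) (κ := Fin Q) (fun a => {a})
    (p := 1 / Q) (by positivity) (by rwa [div_le_one (by positivity)]) (by simp)
    (by simpa only [Fintype.card_fin] using hlog)
  obtain ⟨a, -, ha⟩ := Finset.exists_card_fiber_le_of_card_le_nsmul (s := E) (f := c)
    (t := Finset.univ) (b := (E.card : ℝ) / Q) Finset.univ_nonempty (by
      rw [Finset.card_univ, Fintype.card_fin, nsmul_eq_mul, mul_div_cancel₀ _ (by positivity)])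
  refine ⟨{e | c e ∈ ({a} : Finset (Fin Q))}, hc a, ?_⟩
  simpa only [Set.mem_ofPred_eq, Finset.mem_singleton] using ha

open Classical in
theorem exists_isExpanding_le_card_filter_notMem (hQ : 0 < Q) (E : Finset (Sym2 V))
    (hlog : Real.log Q + (Δ * x + y) * Real.log (Fintype.card V + 1) <
      (1 - 1 / (Q : ℝ)) ^ Δ * (x * y)) :
    ∃ R : Set (Sym2 V), IsExpanding R Finset.univ Finset.univ x y Δ ∧
      (E.card : ℝ) / Q ≤ (E.filter (· ∉ R)).card := by
  have : NeZero Q := ⟨hQ.ne'⟩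
  have hQ1 : (1 : ℝ) ≤ Q := Nat.one_le_cast.mpr hQ
  have hinv : 1 / (Q : ℝ) ≤ 1 := by rwa [div_le_one (by positivity)]
  obtain ⟨c, hc⟩ := exists_coloring_isExpanding (V := V) (κ := Fin Q) (fun a => {a}ᶜ)
    (p := 1 - 1 / Q) (sub_nonneg.mpr hinv) (sub_le_self _ (by positivity))
    (fun a => by
      rw [Finset.card_compl, Finset.card_singleton, Fintype.card_fin, Nat.cast_pred hQ, sub_div,
        div_self (by positivity)])
    (by simpa only [Fintype.card_fin] using hlog)
  obtain ⟨a, -, ha⟩ := Finset.exists_le_card_fiber_of_nsmul_le_card_of_maps_to (s := E) (f := c)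
    (t := Finset.univ) (b := (E.card : ℝ) / Q) (fun _ _ => Finset.mem_univ _)
    Finset.univ_nonempty (by
      rw [Finset.card_univ, Fintype.card_fin, nsmul_eq_mul, mul_div_cancel₀ _ (by positivity)])
  refine ⟨{e | c e ∈ ({a}ᶜ : Finset (Fin Q))}, hc a, ?_⟩
  simpa only [Set.mem_ofPred_eq, Finset.mem_compl, Finset.mem_singleton, not_not] using ha

end ColourClasses

section LayeredGraph

variable {V : Type*}

/-- The graph in which the hubs `A` are joined to every vertex, and two further vertices are
adjacent if their pair lies in the set `R g` attached to the larger `g` of their two levels. -/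
def layeredGraph (A : Finset V) (lev : V → ℕ) (R : ℕ → Set (Sym2 V)) : SimpleGraph V where
  Adj u v := u ≠ v ∧ (u ∈ A ∨ v ∈ A ∨ s(u, v) ∈ R (max (lev u) (lev v)))
  symm := ⟨fun u v ⟨hne, h⟩ => ⟨hne.symm, by
    rw [Sym2.eq_swap, max_comm]
    tauto⟩⟩
  loopless := ⟨fun _ h => h.1 rfl⟩

theorem layeredGraph_adj_of_mem {A : Finset V} {lev : V → ℕ} {R : ℕ → Set (Sym2 V)} {a b : V}
    (ha : a ∈ A) (hb : b ≠ a) : (layeredGraph A lev R).Adj a b :=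
  ⟨hb.symm, Or.inl ha⟩

variable [Fintype V] [DecidableEq V]

/-- The vertices on level `g` that are not hubs: the slots for the `g`-th group of vertices in a
greedy embedding. -/
def levelSlots (A : Finset V) (lev : V → ℕ) (g : ℕ) : Finset V :=
  Finset.univ.filter fun v => v ∉ A ∧ lev v = g

/-- The pairs of vertices outside the hubs whose larger level is `g`. -/
def levelPairs (A : Finset V) (lev : V → ℕ) (g : ℕ) : Finset (Sym2 V) :=
  ((Finset.range (g + 1)).biUnion (levelSlots A lev) ×ˢ levelSlots A lev g).image
    fun p => s(p.1, p.2)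

variable {A : Finset V} {lev : V → ℕ} {R : ℕ → Set (Sym2 V)}

theorem mem_levelSlots {g : ℕ} {v : V} : v ∈ levelSlots A lev g ↔ v ∉ A ∧ lev v = g := by
  simp [levelSlots]

theorem sum_card_levelSlots_le (A : Finset V) (lev : V → ℕ) (s : Finset ℕ) :
    ∑ g ∈ s, (levelSlots A lev g).card ≤ Fintype.card V - A.card := by
  have hdisj : (s : Set ℕ).PairwiseDisjoint (levelSlots A lev) := fun i _ j _ hij =>
    Finset.disjoint_left.mpr fun v hi hj =>
      hij ((mem_levelSlots.mp hi).2.symm.trans (mem_levelSlots.mp hj).2)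
  rw [← Finset.card_biUnion hdisj, ← Finset.card_compl]
  refine Finset.card_le_card fun v hv => ?_
  obtain ⟨g, -, hg⟩ := Finset.mem_biUnion.mp hv
  exact Finset.mem_compl.mpr (mem_levelSlots.mp hg).1

theorem levelSlots_const (A : Finset V) (g : ℕ) : levelSlots A (fun _ => g) g = Aᶜ := by
  ext v
  simp [mem_levelSlots]

theorem mk_mem_levelPairs {u v : V} (hu : u ∉ A) (hv : v ∉ A) (h : lev u ≤ lev v) :
    s(u, v) ∈ levelPairs A lev (lev v) :=
  Finset.mem_image.mpr ⟨(u, v), Finset.mem_product.mpr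
    ⟨Finset.mem_biUnion.mpr ⟨lev u, Finset.mem_range.mpr (Nat.lt_succ_of_le h),
      mem_levelSlots.mpr ⟨hu, rfl⟩⟩, mem_levelSlots.mpr ⟨hv, rfl⟩⟩, rfl⟩

theorem card_levelPairs_le (A : Finset V) (lev : V → ℕ) (g : ℕ) :
    (levelPairs A lev g).card ≤
      (∑ i ∈ Finset.range (g + 1), (levelSlots A lev i).card) * (levelSlots A lev g).card :=
  Finset.card_image_le.trans ((Finset.card_product _ _).trans_le
    (Nat.mul_le_mul_right _ Finset.card_biUnion_le))

theorem IsExpanding.layeredGraph {x y g Δ : ℕ}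
    (h : IsExpanding (R g) Finset.univ Finset.univ x y Δ) :
    IsExpanding (layeredGraph A lev R).edgeSet
      ((Finset.range (g + 1)).biUnion (levelSlots A lev)) (levelSlots A lev g) x y Δ := by
  intro N Y hN hNX hNcard hYZ hYcard hNY
  obtain ⟨i, b, hb, hR⟩ := h N Y hN (fun _ => Finset.subset_univ _) hNcard
    (Finset.subset_univ _) hYcard hNY
  refine ⟨i, b, hb, fun u hu => ⟨?_, Or.inr (Or.inr ?_)⟩⟩
  · exact fun hub : u = b => Finset.disjoint_left.mp (hNY i) hu (hub ▸ hb)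
  · obtain ⟨j, hj, hju⟩ := Finset.mem_biUnion.mp (hNX i hu)
    rw [(mem_levelSlots.mp hju).2, (mem_levelSlots.mp (hYZ hb)).2,
      max_eq_right (Nat.lt_succ_iff.mp (Finset.mem_range.mp hj))]
    exact hR u hu

open Classical in
theorem edgeSet_layeredGraph_subset {G : ℕ} (hG : ∀ v, v ∉ A → lev v < G) :
    (layeredGraph A lev R).edgeSet ⊆
      ((A ×ˢ Finset.univ).image (fun p : V × V => s(p.1, p.2)) ∪
        (Finset.range G).biUnion fun g => (levelPairs A lev g).filter (· ∈ R g) :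
        Finset (Sym2 V)) := by
  intro e he
  induction e with | _ u v
  wlog hle : lev u ≤ lev v generalizing u v
  · rw [Sym2.eq_swap]
    exact this v u ((mem_edgeSet _).mp he).symm (le_of_not_ge hle)
  obtain ⟨-, hadj⟩ := he
  by_cases hu : u ∈ A
  · exact Finset.mem_union_left _ (Finset.mem_image.mpr ⟨(u, v), by simp [hu], rfl⟩)
  by_cases hv : v ∈ A
  · exact Finset.mem_union_left _ (Finset.mem_image.mpr ⟨(v, u), by simp [hv], Sym2.eq_swap⟩)
  have hR := (hadj.resolve_left hu).resolve_left hv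
  rw [max_eq_right hle] at hR
  exact Finset.mem_union_right _ (Finset.mem_biUnion.mpr ⟨lev v, Finset.mem_range.mpr (hG v hv),
    Finset.mem_filter.mpr ⟨mk_mem_levelPairs hu hv hle, hR⟩⟩)

open Classical in
theorem numEdges_layeredGraph_le {G : ℕ} (hG : ∀ v, v ∉ A → lev v < G) :
    numEdges (layeredGraph A lev R) ≤ A.card * Fintype.card V +
      ∑ g ∈ Finset.range G, ((levelPairs A lev g).filter (· ∈ R g)).card := by
  refine (Set.ncard_le_ncard (edgeSet_layeredGraph_subset hG) (Finset.finite_toSet _)).trans ?_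
  rw [Set.ncard_coe_finset]
  refine (Finset.card_union_le _ _).trans (Nat.add_le_add ?_ Finset.card_biUnion_le)
  exact Finset.card_image_le.trans (Finset.card_product _ _).le

theorem isUniversal_layeredGraph {n m x y P G τ d : ℕ} {Δ : ℕ → ℕ} (hn : Fintype.card V = n)
    (hG : ∀ v, v ∉ A → lev v < G) (hd : 4 * m ≤ d * n) (hw : 2 * (G * y * (d + 1)) ≤ n)
    (hsum : τ + ∑ g ∈ Finset.range G, ((levelSlots A lev g).card + x * (P * P + 1)) +
      G * y * (d + 1) ≤ n)
    (hP : 2 * m < (P + 1) * τ)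
    (hΔ : ∀ g < G, 2 * m <
      (Δ g + 1) * (τ + ∑ i ∈ Finset.range g, (levelSlots A lev i).card))
    (hR : ∀ g < G, IsExpanding (R g) Finset.univ Finset.univ x y (Δ g)) :
    IsUniversal n m (layeredGraph A lev R) := by
  refine isUniversal_of_isExpanding hn (fun a ha b hb => layeredGraph_adj_of_mem ha hb)
    (fun v => ?_) hd hw hsum hP hΔ fun g hg => (hR g hg).layeredGraph
  by_cases hv : v ∈ A
  · exact Or.inl hv
  · exact Or.inr ⟨lev v, hG v hv, mem_levelSlots.mpr ⟨hv, rfl⟩⟩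

open Classical in
theorem card_filter_notMem_le_numEdges_compl_layeredGraph :
    ((Aᶜ.offDiag.image fun p => s(p.1, p.2)).filter (· ∉ R 0)).card ≤
      numEdges (layeredGraph A (fun _ => 0) R)ᶜ := by
  rw [numEdges_eq_card]
  refine Finset.card_le_card fun e he => ?_
  obtain ⟨he, heR⟩ := Finset.mem_filter.mp he
  obtain ⟨⟨u, v⟩, huv, rfl⟩ := Finset.mem_image.mp he
  obtain ⟨hu, hv, hne⟩ := Finset.mem_offDiag.mp huv
  rw [mem_edgeFinset, mem_edgeSet, compl_adj]
  exact ⟨hne, fun ⟨_, h⟩ =>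
    heR ((h.resolve_left (Finset.mem_compl.mp hu)).resolve_left (Finset.mem_compl.mp hv))⟩

end LayeredGraph

section LayeredBounds

variable {n m : ℕ} {A : Finset (Fin n)}

theorem univMin_le_of_levels {lev : Fin n → ℕ} {x y P G τ d : ℕ} {Δ Q : ℕ → ℕ}
    (hG : ∀ v, v ∉ A → lev v < G) (hQ : ∀ g, 0 < Q g)
    (hd : 4 * m ≤ d * n) (hw : 2 * (G * y * (d + 1)) ≤ n)
    (hsum : τ + ∑ g ∈ Finset.range G, ((levelSlots A lev g).card + x * (P * P + 1)) +
      G * y * (d + 1) ≤ n)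
    (hP : 2 * m < (P + 1) * τ)
    (hΔ : ∀ g < G, 2 * m <
      (Δ g + 1) * (τ + ∑ i ∈ Finset.range g, (levelSlots A lev i).card))
    (hlog : ∀ g < G, Real.log (Q g) + (Δ g * x + y) * Real.log (n + 1) <
      (1 / (Q g : ℝ)) ^ Δ g * (x * y)) :
    (univMin n m : ℝ) ≤ A.card * n + ∑ g ∈ Finset.range G,
      (∑ i ∈ Finset.range (g + 1), ((levelSlots A lev i).card : ℝ)) *
        (levelSlots A lev g).card / Q g := by
  classical
  choose! R hR hRcard using fun g (hg : g < G) =>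
    exists_isExpanding_card_filter_mem_le (hQ g) (levelPairs A lev g)
      (by simpa only [Fintype.card_fin] using hlog g hg)
  have huniv : IsUniversal n m (layeredGraph A lev R) :=
    isUniversal_layeredGraph (Fintype.card_fin n) hG hd hw hsum hP hΔ hR
  have hnum := (univMin_le huniv).trans (numEdges_layeredGraph_le (R := R) hG)
  rw [Fintype.card_fin] at hnum
  refine (Nat.cast_le.mpr hnum).trans ?_
  rw [Nat.cast_add, Nat.cast_mul, Nat.cast_sum]
  gcongr with g hg
  refine (hRcard g (Finset.mem_range.mp hg)).trans ?_
  gcongr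
  exact_mod_cast card_levelPairs_le A lev g

theorem le_unavoidMax_of_hubs {e x y P Q τ d : ℕ} (he : e + m = n.choose 2) (hQ : 0 < Q)
    (hd : 4 * m ≤ d * n) (hw : 2 * (y * (d + 1)) ≤ n)
    (hsum : τ + ((n - A.card) + x * (P * P + 1)) + y * (d + 1) ≤ n)
    (hP : 2 * m < (P + 1) * τ)
    (hlog : Real.log Q + (P * x + y) * Real.log (n + 1) < (1 - 1 / (Q : ℝ)) ^ P * (x * y)) :
    ((n - A.card).choose 2 : ℝ) / Q ≤ unavoidMax n e := by
  classical
  have hAc : Aᶜ.card = n - A.card := by rw [Finset.card_compl, Fintype.card_fin]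
  let E : Finset (Sym2 (Fin n)) := Aᶜ.offDiag.image fun p => s(p.1, p.2)
  obtain ⟨R, hR, hRcard⟩ := exists_isExpanding_le_card_filter_notMem hQ E
    (by simpa only [Fintype.card_fin] using hlog)
  let U := layeredGraph A (fun _ => 0) fun _ => R
  have huniv : IsUniversal n m U :=
    isUniversal_layeredGraph (G := 1) (Δ := fun _ => P) (Fintype.card_fin n)
      (fun _ _ => one_pos) hd (by rwa [one_mul])
      (by rwa [Finset.sum_range_one, levelSlots_const, hAc, one_mul]) hP
      (fun g hg => by rwa [Nat.lt_one_iff.mp hg, Finset.sum_range_zero]) fun _ _ => hR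
  have hE : E.card = (n - A.card).choose 2 := hAc ▸ Sym2.card_image_offDiag _
  have hcompl : (E.filter (· ∉ R)).card ≤ numEdges Uᶜ :=
    card_filter_notMem_le_numEdges_compl_layeredGraph (R := fun _ => R)
  have hU : numEdges Uᶜ ≤ unavoidMax n e := by
    have := univMin_le huniv
    have := univMin_add_unavoidMax he
    have := numEdges_add_numEdges_compl_fin U
    omega
  rw [← hE]
  exact hRcard.trans (Nat.cast_le.mpr (hcompl.trans hU))

end LayeredBounds

section DyadicLevels

variable {n h K g : ℕ}

/-- The level of a vertex when the vertices after the first `h` are cut into consecutive blocks of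
lengths `K, 2 K, 4 K, …`. -/
def dyadicLevel (h K : ℕ) (v : Fin n) : ℕ := Nat.log 2 ((v - h) / K + 1)

/-- The first `h` vertices, which serve as hubs. -/
def initialVertices (n h : ℕ) : Finset (Fin n) := Finset.univ.filter fun v => (v : ℕ) < h

theorem mem_initialVertices {v : Fin n} : v ∈ initialVertices n h ↔ (v : ℕ) < h := by
  simp [initialVertices]

theorem card_initialVertices (hh : h ≤ n) : (initialVertices n h).card = h := by
  rw [initialVertices, Fin.card_filter_val_lt, min_eq_right hh]

theorem dyadicLevel_lt_iff (hK : 0 < K) {v : Fin n} :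
    dyadicLevel h K v < g ↔ (v : ℕ) - h < (2 ^ g - 1) * K := by
  rw [dyadicLevel, Nat.log_lt_iff_lt_pow one_lt_two (Nat.add_one_ne_zero _),
    ← Nat.lt_sub_iff_add_lt, Nat.div_lt_iff_lt_mul hK]

theorem card_levelSlots_dyadicLevel_le (hK : 0 < K) :
    (levelSlots (initialVertices n h) (dyadicLevel h K) g).card ≤ 2 ^ g * K := by
  have hblock : (Finset.Ico ((2 ^ g - 1) * K) ((2 ^ (g + 1) - 1) * K)).card = 2 ^ g * K := by
    rw [Nat.card_Ico, ← Nat.sub_mul, pow_succ]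
    congr 1
    omega
  rw [← hblock]
  refine Finset.card_le_card_of_injOn (fun v => (v : ℕ) - h) (fun v hv => ?_)
    fun u hu v hv (huv : (u : ℕ) - h = v - h) => ?_
  · have hlev := (mem_levelSlots.mp hv).2
    rw [Finset.mem_coe, Finset.mem_Ico, ← dyadicLevel_lt_iff hK, ← not_lt,
      ← dyadicLevel_lt_iff hK, hlev]
    exact ⟨lt_irrefl g, Nat.lt_succ_self g⟩
  · have hu := (mem_levelSlots.mp hu).1
    have hv := (mem_levelSlots.mp hv).1
    rw [mem_initialVertices] at hu hv
    exact Fin.ext (by omega)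

theorem sum_card_levelSlots_dyadicLevel_le (hK : 0 < K) :
    ∑ i ∈ Finset.range g, (levelSlots (initialVertices n h) (dyadicLevel h K) i).card ≤
      2 ^ g * K :=
  calc ∑ i ∈ Finset.range g, (levelSlots (initialVertices n h) (dyadicLevel h K) i).card
      ≤ ∑ i ∈ Finset.range g, 2 ^ i * K :=
        Finset.sum_le_sum fun i _ => card_levelSlots_dyadicLevel_le hK
    _ ≤ 2 ^ g * K := by
        rw [← Finset.sum_mul, Nat.geomSum_eq le_rfl]
        exact Nat.mul_le_mul_right _ (by simp)

theorem le_sum_card_levelSlots_dyadicLevel (hK : 0 < K) (hg : (2 ^ g - 1) * K + h ≤ n) :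
    (2 ^ g - 1) * K ≤
      ∑ i ∈ Finset.range g, (levelSlots (initialVertices n h) (dyadicLevel h K) i).card := by
  refine le_trans ?_ Finset.card_biUnion_le
  rw [← Fintype.card_fin ((2 ^ g - 1) * K), ← Finset.card_univ]
  refine Finset.card_le_card_of_injOn (fun j => (⟨h + j, by omega⟩ : Fin n)) (fun j _ => ?_)
    fun i _ j _ hij => Fin.ext (Nat.add_left_cancel (Fin.ext_iff.mp hij))
  rw [Finset.mem_coe, Finset.mem_biUnion]
  refine ⟨dyadicLevel h K ⟨h + j, by omega⟩, ?_, mem_levelSlots.mpr ⟨?_, rfl⟩⟩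
  · simp [dyadicLevel_lt_iff hK]
  · simp [mem_initialVertices]

theorem exists_dyadic_cover (n h : ℕ) (hK : 0 < K) :
    ∃ G, n ≤ h + (2 ^ G - 1) * K ∧ ∀ g < G, (2 ^ g - 1) * K + h ≤ n := by
  have hex : ∃ G, n ≤ h + (2 ^ G - 1) * K := by
    have hpow : n ≤ 2 ^ n - 1 := Nat.le_sub_one_of_lt Nat.lt_two_pow_self
    exact ⟨n, hpow.trans ((Nat.le_mul_of_pos_right _ hK).trans (Nat.le_add_left _ _))⟩
  refine ⟨Nat.find hex, Nat.find_spec hex, fun g hg => ?_⟩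
  have := Nat.find_min hex hg
  omega

theorem dyadic_level_cost_le (hK : 0 < K) :
    (∑ i ∈ Finset.range (g + 1),
        ((levelSlots (initialVertices n h) (dyadicLevel h K) i).card : ℝ)) *
      (levelSlots (initialVertices n h) (dyadicLevel h K) g).card / ((8 ^ g : ℕ) : ℝ) ≤
      2 * (K : ℝ) ^ 2 * (1 / 2) ^ g := by
  have hsum : ∑ i ∈ Finset.range (g + 1),
      ((levelSlots (initialVertices n h) (dyadicLevel h K) i).card : ℝ) ≤ 2 ^ (g + 1) * K := by
    exact_mod_cast sum_card_levelSlots_dyadicLevel_le hK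
  have hcard : ((levelSlots (initialVertices n h) (dyadicLevel h K) g).card : ℝ) ≤ 2 ^ g * K := by
    exact_mod_cast card_levelSlots_dyadicLevel_le hK
  calc _ ≤ (2 ^ (g + 1) * (K : ℝ)) * (2 ^ g * K) / ((8 ^ g : ℕ) : ℝ) := by gcongr
    _ = 2 * (K : ℝ) ^ 2 * (2 * 2 / 8) ^ g := by
        rw [div_pow, mul_pow, Nat.cast_pow, Nat.cast_ofNat]
        ring
    _ = 2 * (K : ℝ) ^ 2 * (1 / 2) ^ g := by norm_num

-- Level `g` has density `8⁻ᵍ` and at most about `4ᵍ K²` pairs, so the costs of the levels decay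
-- geometrically.
theorem univMin_le_of_dyadic {m τ s P d G : ℕ} (hK : 0 < K) (hh : h ≤ n)
    (hG : ∀ g < G, (2 ^ g - 1) * K + h ≤ n) (hG' : n ≤ h + (2 ^ G - 1) * K)
    (hd : 4 * m ≤ d * n) (hw : 2 * (G * s * (d + 1)) ≤ n)
    (hsum : τ + G * (s * (P * P + 1)) + G * s * (d + 1) ≤ h)
    (hP : 2 * m < (P + 1) * τ)
    (hlog : ∀ g < G, ∀ Δ : ℕ, Δ * (τ + (2 ^ g - 1) * K) ≤ 2 * m →
      Real.log ((8 ^ g : ℕ) : ℝ) + ((Δ : ℝ) * s + s) * Real.log (n + 1) <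
        (1 / ((8 ^ g : ℕ) : ℝ)) ^ Δ * (s * s)) :
    (univMin n m : ℝ) ≤ h * n + 4 * (K : ℝ) ^ 2 := by
  have hτ : 0 < τ := Nat.pos_of_mul_pos_left (pos_of_gt hP)
  have hlevels := sum_card_levelSlots_le (initialVertices n h) (dyadicLevel h K) (Finset.range G)
  rw [card_initialVertices hh, Fintype.card_fin] at hlevels
  have hmin := univMin_le_of_levels (n := n) (A := initialVertices n h) (lev := dyadicLevel h K)
    (Δ := fun g => 2 * m / (τ + (2 ^ g - 1) * K)) (Q := fun g => 8 ^ g)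
    (fun v hv => by
      rw [mem_initialVertices] at hv
      rw [dyadicLevel_lt_iff hK]
      omega)
    (fun g => by positivity) hd hw
    (by
      rw [Finset.sum_add_distrib, Finset.sum_const, Finset.card_range, smul_eq_mul]
      omega)
    hP
    (fun g hg => (Nat.lt_mul_div_succ _ (Nat.add_pos_left hτ _)).trans_le
      ((mul_comm _ _).trans_le (Nat.mul_le_mul_left _
        (Nat.add_le_add_left (le_sum_card_levelSlots_dyadicLevel hK (hG g hg)) τ))))
    fun g hg => hlog g hg _ (Nat.div_mul_le_self _ _)
  rw [card_initialVertices hh] at hmin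
  refine hmin.trans (add_le_add le_rfl ?_)
  have hgeom : ∑ g ∈ Finset.range G, ((1 : ℝ) / 2) ^ g ≤ 2 :=
    (summable_geometric_two.sum_le_tsum _ fun i _ => by positivity).trans_eq tsum_geometric_two
  calc _ ≤ ∑ g ∈ Finset.range G, 2 * (K : ℝ) ^ 2 * (1 / 2) ^ g :=
        Finset.sum_le_sum fun g _ => dyadic_level_cost_le hK
    _ = 2 * (K : ℝ) ^ 2 * ∑ g ∈ Finset.range G, (1 / 2 : ℝ) ^ g := (Finset.mul_sum _ _ _).symm
    _ ≤ 2 * (K : ℝ) ^ 2 * 2 := by gcongr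
    _ = 4 * (K : ℝ) ^ 2 := by ring

end DyadicLevels

section SparseUpperBound

theorem eventually_log_pow_le :
    ∀ᶠ m : ℕ in Filter.atTop, 10 ≤ Real.log m ∧ 10 ^ 5 * Real.log m ^ 14 ≤ m := by
  have hlog : ∀ᶠ x : ℝ in Filter.atTop, 10 ≤ Real.log x :=
    Real.tendsto_log_atTop.eventually_ge_atTop 10
  have hpow := (Real.isLittleO_pow_log_id_atTop (n := 14)).bound
    (show (0 : ℝ) < 1 / 10 ^ 5 by positivity)
  refine tendsto_natCast_atTop_atTop.eventually
    (p := fun x : ℝ => 10 ≤ Real.log x ∧ 10 ^ 5 * Real.log x ^ 14 ≤ x) ?_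
  filter_upwards [hlog, hpow, Filter.eventually_ge_atTop 0] with x hx hx14 hx0
  rw [id, Real.norm_of_nonneg (by positivity), Real.norm_of_nonneg hx0] at hx14
  exact ⟨hx, by linarith⟩

theorem log_eight_le : Real.log 8 ≤ 2.1 := by
  have := Real.log_two_lt_d9
  rw [show (8 : ℝ) = 2 ^ 3 by norm_num, Real.log_pow]
  norm_num
  linarith

theorem exp_neg_le_inv_eight_pow_pow {g Δ : ℕ} {l : ℝ} (h : (g : ℝ) * Δ ≤ l / 10) :
    Real.exp (-(l / 4)) ≤ (1 / ((8 ^ g : ℕ) : ℝ)) ^ Δ := by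
  have hpow : (1 / ((8 ^ g : ℕ) : ℝ)) ^ Δ = Real.exp (-(g * Δ * Real.log 8)) := by
    rw [Real.exp_neg, ← Nat.cast_mul, Real.exp_nat_mul, Real.exp_log (by norm_num : (0 : ℝ) < 8),
      Nat.cast_pow, Nat.cast_ofNat, one_div, inv_pow, ← pow_mul]
  have hmul : g * Δ * Real.log 8 ≤ g * Δ * 2.1 :=
    mul_le_mul_of_nonneg_left log_eight_le (by positivity)
  have hnonneg : (0 : ℝ) ≤ g * Δ := by positivity
  rw [hpow]
  exact Real.exp_le_exp.mpr (by linarith)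

variable {l : ℝ}

theorem ten_mul_pow_le_exp_div_four (hl : 1 ≤ l) (hexp : 10 ^ 5 * l ^ 14 ≤ Real.exp l) :
    10 * l ^ 3 ≤ Real.exp (l / 4) := by
  refine le_of_pow_le_pow_left₀ (n := 4) (by norm_num) (Real.exp_pos _).le ?_
  calc (10 * l ^ 3) ^ 4 = 10 ^ 4 * l ^ 12 := by ring
    _ ≤ 10 ^ 5 * l ^ 14 := by
        gcongr <;> norm_num
    _ ≤ Real.exp l := hexp
    _ = Real.exp (l / 4) ^ 4 := by
        rw [← Real.exp_nat_mul]
        ring_nf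

theorem log_eight_pow_add_lt {N : ℝ} {g Δ s : ℕ} (hl : 10 ≤ l)
    (hexp : 10 ^ 5 * l ^ 14 ≤ Real.exp l) (hs : Real.exp (l / 2) ≤ s) (hg : (g : ℝ) + 1 ≤ l)
    (hΔ : (Δ : ℝ) ≤ 2 * l ^ 2) (hgΔ : (g : ℝ) * Δ ≤ l / 10) (hN : N ≤ 2 * l) :
    Real.log ((8 ^ g : ℕ) : ℝ) + ((Δ : ℝ) * s + s) * N <
      (1 / ((8 ^ g : ℕ) : ℝ)) ^ Δ * (s * s) := by
  have hl0 : 0 < l := by linarith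
  have hs1 : (1 : ℝ) ≤ s := (Real.one_le_exp (by positivity)).trans hs
  have hlog : Real.log ((8 ^ g : ℕ) : ℝ) ≤ l * 2.1 := by
    rw [Nat.cast_pow, Real.log_pow, Nat.cast_ofNat]
    exact mul_le_mul (by linarith) log_eight_le (Real.log_nonneg (by norm_num)) hl0.le
  have hl3 : 100 * l ≤ l ^ 3 := by nlinarith
  calc Real.log ((8 ^ g : ℕ) : ℝ) + ((Δ : ℝ) * s + s) * N
      ≤ l * 2.1 + ((Δ : ℝ) * s + s) * (2 * l) := by gcongr
    _ ≤ l * 2.1 + (2 * l ^ 2 * s + s) * (2 * l) := by gcongr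
    _ = l * 2.1 + s * (4 * l ^ 3 + 2 * l) := by ring
    _ ≤ s * (l * 2.1) + s * (4 * l ^ 3 + 2 * l) := by
        exact add_le_add_left (le_mul_of_one_le_left (by positivity) hs1) _
    _ = s * (4 * l ^ 3 + 4.1 * l) := by ring
    _ < s * (10 * l ^ 3) := by
        gcongr
        linarith
    _ ≤ s * Real.exp (l / 4) := by
        gcongr
        exact ten_mul_pow_le_exp_div_four (by linarith) hexp
    _ = Real.exp (-(l / 4)) * (s * Real.exp (l / 2)) := by
        rw [mul_left_comm, ← Real.exp_add]
        ring_nf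
    _ ≤ (1 / ((8 ^ g : ℕ) : ℝ)) ^ Δ * (s * s) := by
        gcongr
        exact exp_neg_le_inv_eight_pow_pow hgΔ

variable {n m : ℕ} {K : ℕ}

theorem add_one_le_of_dyadic {g : ℕ} (hl : 10 ≤ l) (hm : 0 < m) (hK : 20 * (m : ℝ) ≤ K * l)
    (hn : n ≤ 2 * m) (hg : (2 ^ g - 1) * K ≤ n) : (g : ℝ) + 1 ≤ l := by
  have hg1 : (g : ℝ) ≤ ((2 ^ g - 1 : ℕ) : ℝ) :=
    Nat.cast_le.mpr (Nat.le_sub_one_of_lt Nat.lt_two_pow_self)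
  have hgK : ((2 ^ g - 1 : ℕ) : ℝ) * K ≤ 2 * m := by exact_mod_cast hg.trans hn
  have hgm : (g : ℝ) * (20 * m) ≤ l / 10 * (20 * m) :=
    calc (g : ℝ) * (20 * m) ≤ ((2 ^ g - 1 : ℕ) : ℝ) * (K * l) := by gcongr
      _ = ((2 ^ g - 1 : ℕ) : ℝ) * K * l := by ring
      _ ≤ 2 * m * l := by gcongr
      _ = l / 10 * (20 * m) := by ring
  have := le_of_mul_le_mul_right hgm (by positivity)
  linarith

theorem levels_le_of_dyadic {G : ℕ} (hl : 10 ≤ l) (hm : 0 < m) (hK : 20 * (m : ℝ) ≤ K * l)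
    (hn : n ≤ 2 * m) (hG : ∀ g < G, (2 ^ g - 1) * K ≤ n) : (G : ℝ) ≤ l := by
  cases G with
  | zero => linarith [Nat.cast_zero (R := ℝ)]
  | succ g =>
    rw [Nat.cast_succ]
    exact add_one_le_of_dyadic hl hm hK hn (hG g g.lt_succ_self)

theorem mul_le_of_dyadic {g Δ τ : ℕ} (hl : 0 ≤ l) (hm : 0 < m) (hK : 20 * (m : ℝ) ≤ K * l)
    (hΔ : Δ * (τ + (2 ^ g - 1) * K) ≤ 2 * m) : (g : ℝ) * Δ ≤ l / 10 := by
  have hgK : g * Δ * K ≤ 2 * m :=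
    calc g * Δ * K = Δ * (g * K) := by ring
      _ ≤ Δ * ((2 ^ g - 1) * K) := by
          gcongr
          exact Nat.le_sub_one_of_lt Nat.lt_two_pow_self
      _ ≤ Δ * (τ + (2 ^ g - 1) * K) := by
          gcongr
          exact Nat.le_add_left _ _
      _ ≤ 2 * m := hΔ
  have hgm : (g : ℝ) * Δ * (20 * m) ≤ l / 10 * (20 * m) :=
    calc (g : ℝ) * Δ * (20 * m) ≤ g * Δ * (K * l) := by gcongr
      _ = ((g * Δ * K : ℕ) : ℝ) * l := by
          push_cast
          ring
      _ ≤ ((2 * m : ℕ) : ℝ) * l := by gcongr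
      _ = l / 10 * (20 * m) := by
          push_cast
          ring
  exact le_of_mul_le_mul_right hgm (by positivity)

theorem dyadic_overhead_le {τ G s P d : ℕ} (hl : 10 ≤ l) (hm : 10 ^ 5 * l ^ 14 ≤ m)
    (hτ : (m : ℝ) ≤ l ^ 2 * τ) (hG : (G : ℝ) ≤ l) (hs : (s : ℝ) ≤ 2 * √m)
    (hP : (P : ℝ) ≤ 2 * l ^ 2) (hd : (d : ℝ) ≤ l) :
    G * (s * (P * P + 1)) + G * s * (d + 1) ≤ 3 * τ := by
  have hl0 : 0 < l := by linarith
  have hsqrt : 300 * l ^ 7 ≤ √m := by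
    refine Real.le_sqrt_of_sq_le (le_trans ?_ hm)
    rw [mul_pow, ← pow_mul]
    gcongr
    norm_num
  have hPd : (P : ℝ) * P + d + 2 ≤ 5 * l ^ 4 := by
    calc (P : ℝ) * P + d + 2 ≤ 2 * l ^ 2 * (2 * l ^ 2) + l + 2 := by gcongr
      _ ≤ 5 * l ^ 4 := by nlinarith [pow_le_pow_left₀ (by norm_num) hl 3]
  have hreal : (G : ℝ) * (s * (P * P + 1)) + G * s * (d + 1) ≤ 3 * τ := by
    refine le_of_mul_le_mul_left ?_ (pow_pos hl0 2)
    calc l ^ 2 * ((G : ℝ) * (s * (P * P + 1)) + G * s * (d + 1))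
        = l ^ 2 * (G * s * (P * P + d + 2)) := by ring
      _ ≤ l ^ 2 * (l * (2 * √m) * (5 * l ^ 4)) := by gcongr
      _ = √m * (10 * l ^ 7) := by ring
      _ ≤ √m * (3 * √m) := by
          refine mul_le_mul_of_nonneg_left ?_ (Real.sqrt_nonneg _)
          linarith [pow_pos hl0 7]
      _ = 3 * m := by rw [mul_left_comm, Real.mul_self_sqrt (Nat.cast_nonneg m)]
      _ ≤ l ^ 2 * (3 * τ) := by linarith
  exact_mod_cast hreal

theorem four_mul_le_floor_mul (hl : 2 ≤ l) (hn : 100 * (m / l) ≤ n) : 4 * m ≤ ⌊l⌋₊ * n := by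
  have hfloor := Nat.lt_floor_add_one l
  have hreal : (4 * m : ℝ) ≤ ⌊l⌋₊ * n := by
    calc (4 * m : ℝ) = 4 * l * (m / l) := by
          have : l ≠ 0 := by linarith
          field_simp
      _ ≤ (l - 1) * 100 * (m / l) := by
          refine mul_le_mul_of_nonneg_right ?_ (by positivity)
          linarith
      _ ≤ ⌊l⌋₊ * 100 * (m / l) := by
          gcongr
          linarith
      _ ≤ ⌊l⌋₊ * n := by
          rw [mul_assoc]
          gcongr
  exact_mod_cast hreal

theorem two_mul_lt_floor_add_one_mul {τ : ℕ} (hm : 0 < m) (hτ : (m : ℝ) ≤ l ^ 2 * τ) :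
    2 * m < (⌊2 * l ^ 2⌋₊ + 1) * τ := by
  have hτ0 : (0 : ℝ) < τ :=
    pos_of_mul_pos_right ((Nat.cast_pos.mpr hm).trans_le hτ) (sq_nonneg l)
  have hreal : (2 * m : ℝ) < (⌊2 * l ^ 2⌋₊ + 1) * τ := by
    calc (2 * m : ℝ) ≤ 2 * l ^ 2 * τ := by linarith
      _ < (⌊2 * l ^ 2⌋₊ + 1) * τ := by
          gcongr
          exact Nat.lt_floor_add_one _
  exact_mod_cast hreal

variable {k : ℝ} {τ : ℕ}

theorem six_mul_le_of_le_div_add_one (hl : 1 ≤ l) (hk : 1 ≤ k) (hτ : (τ : ℝ) ≤ k / l + 1)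
    (hn : 100 * k ≤ n) : 6 * τ ≤ n := by
  have hkl : k / l ≤ k := div_le_self (by linarith) hl
  have hreal : 6 * (τ : ℝ) ≤ n := by linarith
  exact_mod_cast hreal

theorem four_mul_mul_le_sq (hl : 0 < l) (hk : l ≤ k) (hτ : (τ : ℝ) ≤ k / l + 1)
    (hn : (n : ℝ) ≤ 2 * (k * l)) : 4 * (τ : ℝ) * n ≤ 16 * k ^ 2 :=
  calc 4 * (τ : ℝ) * n ≤ 4 * (k / l + 1) * (2 * (k * l)) := by
        have : 0 ≤ k / l := div_nonneg (hl.le.trans hk) hl.le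
        gcongr
    _ = 8 * k ^ 2 + 8 * (k * l) := by
        field_simp
        ring
    _ ≤ 16 * k ^ 2 := by nlinarith

theorem log_eight_pow_add_lt_of_dyadic {g Δ s : ℕ} (hl : 10 ≤ l) (hexp : Real.exp l = m)
    (hm : 10 ^ 5 * l ^ 14 ≤ m) (hs : √m ≤ s) (hτ : (m : ℝ) ≤ l ^ 2 * τ)
    (hK : 20 * (m : ℝ) ≤ K * l) (hn : n ≤ 2 * m) (hg : (2 ^ g - 1) * K ≤ n)
    (hΔ : Δ * (τ + (2 ^ g - 1) * K) ≤ 2 * m) :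
    Real.log ((8 ^ g : ℕ) : ℝ) + ((Δ : ℝ) * s + s) * Real.log (n + 1) <
      (1 / ((8 ^ g : ℕ) : ℝ)) ^ Δ * (s * s) := by
  have hl0 : 0 < l := by linarith
  have hm3 : (3 : ℝ) ≤ m := by linarith [one_le_pow₀ (n := 14) (by linarith : 1 ≤ l)]
  have hm0 : 0 < m := by exact_mod_cast (by linarith : (0 : ℝ) < m)
  have hΔl : (Δ : ℝ) ≤ 2 * l ^ 2 := by
    have hτ0 : (0 : ℝ) < τ := pos_of_mul_pos_right (by linarith) (sq_nonneg l)
    have hΔτ : (Δ : ℝ) * τ ≤ 2 * m := by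
      exact_mod_cast (Nat.mul_le_mul_left Δ (Nat.le_add_right τ _)).trans hΔ
    exact le_of_mul_le_mul_right (by linarith) hτ0
  have hlogn : Real.log (n + 1) ≤ 2 * l := by
    have hn2 : (n : ℝ) ≤ 2 * m := by exact_mod_cast hn
    rw [Real.log_le_iff_le_exp (by positivity), two_mul, Real.exp_add, hexp]
    nlinarith
  exact log_eight_pow_add_lt hl (hm.trans_eq hexp.symm) (by rwa [Real.exp_half, hexp])
    (add_one_le_of_dyadic hl hm0 hK hn hg) hΔl (mul_le_of_dyadic hl0.le hm0 hK hΔ) hlogn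

theorem univMin_le_of_exp_eq (hl : 10 ≤ l) (hexp : Real.exp l = m) (hm : 10 ^ 5 * l ^ 14 ≤ m)
    (hn : 100 * (m / l) ≤ n) (hn' : n ≤ 2 * m) : (univMin n m : ℝ) ≤ 2000 * (m / l) ^ 2 := by
  have hl0 : 0 < l := by linarith
  have hm0 : (0 : ℝ) < m := hexp ▸ Real.exp_pos l
  have hlm : l ≤ m / l := by
    rw [le_div_iff₀ hl0, ← sq]
    linarith [pow_le_pow_right₀ (by linarith : 1 ≤ l) (by norm_num : 2 ≤ 14), sq_nonneg l]
  obtain ⟨τ, hτ, hτ'⟩ : ∃ τ : ℕ, m / l / l ≤ τ ∧ τ ≤ m / l / l + 1 :=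
    ⟨_, Nat.le_ceil _, (Nat.ceil_lt_add_one (by positivity)).le⟩
  obtain ⟨K, hK, hK'⟩ : ∃ K : ℕ, 20 * (m / l) ≤ K ∧ K ≤ 20 * (m / l) + 1 :=
    ⟨_, Nat.le_ceil _, (Nat.ceil_lt_add_one (by positivity)).le⟩
  obtain ⟨s, hs, hs'⟩ : ∃ s : ℕ, √(m : ℝ) ≤ s ∧ s ≤ √(m : ℝ) + 1 :=
    ⟨_, Nat.le_ceil _, (Nat.ceil_lt_add_one (by positivity)).le⟩
  have hK0 : 0 < K := Nat.cast_pos.mp (hK.trans_lt' (by positivity))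
  have hτm : (m : ℝ) ≤ l ^ 2 * τ := by
    rw [div_div, div_le_iff₀ (by positivity)] at hτ
    linarith
  have hKm : 20 * (m : ℝ) ≤ K * l := by
    rwa [← mul_div_assoc, div_le_iff₀ hl0] at hK
  obtain ⟨G, hG', hG⟩ := exists_dyadic_cover n (4 * τ) hK0
  have hgn : ∀ g < G, (2 ^ g - 1) * K ≤ n := fun g hg => (Nat.le_add_right _ _).trans (hG g hg)
  have hGl : (G : ℝ) ≤ l := levels_le_of_dyadic hl (Nat.cast_pos.mp hm0) hKm hn' hgn
  have hsqrt : 1 ≤ √(m : ℝ) :=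
    Real.one_le_sqrt.mpr (by linarith [one_le_pow₀ (n := 14) (by linarith : 1 ≤ l)])
  have hover : G * (s * (⌊2 * l ^ 2⌋₊ * ⌊2 * l ^ 2⌋₊ + 1)) + G * s * (⌊l⌋₊ + 1) ≤ 3 * τ :=
    dyadic_overhead_le hl hm hτm hGl (by linarith) (Nat.floor_le (by positivity))
      (Nat.floor_le hl0.le)
  have hτn : 6 * τ ≤ n := six_mul_le_of_le_div_add_one (by linarith) (by linarith) hτ' hn
  have hcost : 4 * (τ : ℝ) * n ≤ 16 * (m / l) ^ 2 := by
    refine four_mul_mul_le_sq hl0 hlm hτ' ?_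
    rw [div_mul_cancel₀ _ hl0.ne']
    exact_mod_cast hn'
  refine (univMin_le_of_dyadic hK0 (by omega) hG hG'
    (four_mul_le_floor_mul (by linarith) hn) (by omega) (by omega)
    (two_mul_lt_floor_add_one_mul (Nat.cast_pos.mp hm0) hτm)
    fun g hg Δ hΔ =>
      log_eight_pow_add_lt_of_dyadic hl hexp hm hs hτm hKm hn' (hgn g hg) hΔ).trans ?_
  calc ((4 * τ : ℕ) : ℝ) * n + 4 * (K : ℝ) ^ 2
      ≤ 16 * (m / l) ^ 2 + 4 * (21 * (m / l)) ^ 2 := by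
        push_cast
        gcongr
        linarith
    _ ≤ 2000 * (m / l) ^ 2 := by nlinarith [sq_nonneg (m / l)]

theorem univMin_le_sq (n m : ℕ) : (univMin n m : ℝ) ≤ (n : ℝ) ^ 2 := by
  exact_mod_cast (univMin_le_choose n m).trans (Nat.choose_le_pow n 2)

theorem exists_univMin_le_sparse :
    ∃ C : ℝ, 0 < C ∧ ∀ n m : ℕ, 2 ≤ m →
      (univMin n m : ℝ) ≤ C * ((m : ℝ) ^ 2 / Real.log m ^ 2) := by
  obtain ⟨m₀, hm₀⟩ := Filter.eventually_atTop.mp eventually_log_pow_le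
  refine ⟨4 * (m₀ : ℝ) ^ 2 + 10 ^ 4, by positivity, fun n m hm => ?_⟩
  have hm2 : (2 : ℝ) ≤ m := by exact_mod_cast hm
  have hl0 : 0 < Real.log m := Real.log_pos (by linarith)
  wlog hn : n ≤ 2 * m generalizing n
  · exact (Nat.cast_le.mpr (univMin_le_of_le le_rfl (le_of_not_ge hn))).trans (this _ le_rfl)
  rw [← div_pow, add_mul]
  rcases lt_or_ge m m₀ with hsmall | hlarge
  · have hlm : Real.log m ≤ m₀ :=
      (Real.log_le_self (Nat.cast_nonneg m)).trans (Nat.cast_le.mpr hsmall.le)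
    have hnk : (n : ℝ) ≤ 2 * (m₀ * (m / Real.log m)) := by
      calc (n : ℝ) ≤ 2 * m := by exact_mod_cast hn
        _ = 2 * (Real.log m * (m / Real.log m)) := by rw [mul_div_cancel₀ _ hl0.ne']
        _ ≤ 2 * (m₀ * (m / Real.log m)) := by gcongr
    calc (univMin n m : ℝ) ≤ (n : ℝ) ^ 2 := univMin_le_sq n m
      _ ≤ (2 * (m₀ * (m / Real.log m))) ^ 2 := by gcongr
      _ = 4 * (m₀ : ℝ) ^ 2 * (m / Real.log m) ^ 2 := by ring
      _ ≤ _ := le_add_of_nonneg_right (by positivity)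
  · obtain ⟨hl, hlm⟩ := hm₀ m hlarge
    have hmin : (univMin n m : ℝ) ≤ 10 ^ 4 * (m / Real.log m) ^ 2 := by
      rcases le_or_gt (100 * (m / Real.log m)) (n : ℝ) with hnk | hnk
      · refine (univMin_le_of_exp_eq hl (Real.exp_log (by linarith)) hlm hnk hn).trans ?_
        gcongr
        norm_num
      · calc (univMin n m : ℝ) ≤ (n : ℝ) ^ 2 := univMin_le_sq n m
          _ ≤ (100 * (m / Real.log m)) ^ 2 := by gcongr
          _ = 10 ^ 4 * (m / Real.log m) ^ 2 := by ring
    exact hmin.trans (le_add_of_nonneg_left (by positivity))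

end SparseUpperBound

theorem log_add_one_le_two_mul_log {a : ℝ} (ha : 2 ≤ a) :
    Real.log (a + 1) ≤ 2 * Real.log a := by
  rw [← Nat.cast_two, ← Real.log_pow]
  exact Real.log_le_log (by positivity) (by nlinarith)

section DenseLowerBound

theorem exp_neg_le_one_sub_inv_pow {Q : ℕ} (P : ℕ) (hQ : 2 ≤ Q) :
    Real.exp (-(2 * P / Q)) ≤ (1 - 1 / (Q : ℝ)) ^ P := by
  have hQ' : (2 : ℝ) ≤ Q := by exact_mod_cast hQ
  have hsub : 0 < 1 - 1 / (Q : ℝ) := by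
    rw [sub_pos, div_lt_one (by linarith)]
    linarith
  have hinv : -(2 / (Q : ℝ)) ≤ 1 - (1 - 1 / (Q : ℝ))⁻¹ := by
    rw [le_sub_comm, inv_le_iff_one_le_mul₀ hsub, sub_neg_eq_add]
    field_simp
    nlinarith
  have hstep : Real.exp (-(2 / Q)) ≤ 1 - 1 / (Q : ℝ) :=
    (Real.le_log_iff_exp_le hsub).mp (hinv.trans (Real.one_sub_inv_le_log_of_pos hsub))
  calc Real.exp (-(2 * P / Q)) = Real.exp (-(2 / Q)) ^ P := by
        rw [← Real.exp_nat_mul]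
        ring_nf
    _ ≤ (1 - 1 / (Q : ℝ)) ^ P := pow_le_pow_left₀ (Real.exp_pos _).le hstep P

theorem sq_div_eighteen_le_choose_half {n : ℕ} (hn : 9 ≤ n) :
    (n : ℝ) ^ 2 / 18 ≤ ((n / 2).choose 2 : ℕ) := by
  have hhalf : (n : ℝ) ≤ 2 * ((n / 2 : ℕ) : ℝ) + 1 := by
    exact_mod_cast (show n ≤ 2 * (n / 2) + 1 by omega)
  have hn' : (9 : ℝ) ≤ n := by exact_mod_cast hn
  rw [Nat.cast_choose_two]
  nlinarith

theorem two_mul_div_eighth_le {n : ℕ} (m : ℕ) (hn : 0 < n) :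
    ((2 * m / (n / 8 + 1) : ℕ) : ℝ) ≤ 16 * ((m : ℝ) / n) := by
  have : (0 : ℝ) < n := by exact_mod_cast hn
  have heighth : (n : ℝ) / 8 ≤ (n / 8 + 1 : ℕ) := by
    rw [div_le_iff₀' (by norm_num)]
    exact_mod_cast (by omega : n ≤ 8 * (n / 8 + 1))
  calc ((2 * m / (n / 8 + 1) : ℕ) : ℝ) ≤ ((2 * m : ℕ) : ℝ) / (n / 8 + 1 : ℕ) := Nat.cast_div_le
    _ ≤ ((2 * m : ℕ) : ℝ) / (n / 8) := by gcongr
    _ = 16 * ((m : ℝ) / n) := by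
        push_cast
        field_simp
        ring

theorem sq_div_le_unavoidMax {n e m x y Q : ℕ} (he : e + m = n.choose 2) (hn : 9 ≤ n)
    (hQ : 2 ≤ Q) (hx : 8 * (x * (256 * ((m : ℝ) / n) ^ 2 + 1)) ≤ n)
    (hy : 8 * (y * (4 * ((m : ℝ) / n) + 2)) ≤ n)
    (hlog : Real.log Q + (16 * ((m : ℝ) / n) * x + y) * Real.log (n + 1) <
      Real.exp (-(32 * ((m : ℝ) / n) / Q)) * (x * y)) :
    (n : ℝ) ^ 2 / 18 / Q ≤ unavoidMax n e := by
  obtain ⟨P, hP⟩ : ∃ P, P = 2 * m / (n / 8 + 1) := ⟨_, rfl⟩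
  obtain ⟨d, hd⟩ : ∃ d, d = 4 * m / n + 1 := ⟨_, rfl⟩
  have hP_le : (P : ℝ) ≤ 16 * ((m : ℝ) / n) := hP ▸ two_mul_div_eighth_le m (by omega)
  have hd_le : (d : ℝ) ≤ 4 * ((m : ℝ) / n) + 1 := by
    rw [hd, ← mul_div_assoc]
    exact_mod_cast add_le_add_left (Nat.cast_div_le (α := ℝ) (m := 4 * m) (n := n)) 1
  have hxcost : 8 * (x * (P * P + 1)) ≤ n := by
    have : 8 * ((x : ℝ) * (P * P + 1)) ≤ n := by
      refine le_trans ?_ hx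
      rw [show 256 * ((m : ℝ) / n) ^ 2 = 16 * ((m : ℝ) / n) * (16 * ((m : ℝ) / n)) by ring]
      gcongr
    exact_mod_cast this
  have hycost : 8 * (y * (d + 1)) ≤ n := by
    have : 8 * ((y : ℝ) * (d + 1)) ≤ n :=
      hy.trans' (by gcongr 8 * ((y : ℝ) * ?_); linarith)
    exact_mod_cast this
  have hexpand : Real.log Q + (P * x + y) * Real.log (n + 1) <
      (1 - 1 / (Q : ℝ)) ^ P * (x * y) := by
    refine lt_of_le_of_lt ?_ (hlog.trans_le ?_)
    · gcongr
      exact Real.log_nonneg (by norm_num)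
    · refine mul_le_mul_of_nonneg_right
        ((Real.exp_le_exp.mpr (neg_le_neg ?_)).trans (exp_neg_le_one_sub_inv_pow P hQ))
        (by positivity)
      exact div_le_div_of_nonneg_right (by linarith) Q.cast_nonneg
  have hcard : n - (initialVertices n (n - n / 2)).card = n / 2 := by
    rw [card_initialVertices (Nat.sub_le _ _)]
    omega
  have hhubs := le_unavoidMax_of_hubs (A := initialVertices n (n - n / 2)) (x := x) (y := y)
    (P := P) (Q := Q) (τ := n / 8 + 1) (d := d) he (by omega)
    (hd ▸ (Nat.lt_mul_div_succ _ (by omega)).le.trans_eq (mul_comm _ _)) (by omega) (by omega)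
    (hP ▸ (Nat.lt_mul_div_succ _ (by omega)).trans_eq (mul_comm _ _)) hexpand
  rw [hcard] at hhubs
  refine hhubs.trans' ?_
  gcongr
  exact sq_div_eighteen_le_choose_half hn

theorem log_add_lt_div_mul {w E F L L' D q x y : ℝ} (hF : 0 < F) (hE : E = F * F)
    (hw : 1 ≤ w) (hL : 0 ≤ L) (hLF : 36 * L < F) (hL' : L' ≤ 2 * L) (hq : q ≤ L')
    (hx : E ≤ x) (hy : w ≤ y) (hD0 : 0 ≤ D) (hD : D ≤ w / E) :
    q + (16 * D * x + y) * L' < 1 / F * (x * y) := by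
  have hE0 : 0 < E := by rw [hE]; positivity
  have hx0 : 0 < x := hE0.trans_le hx
  have hy0 : 0 < y := by linarith
  have hDx : D * x ≤ x * y / E := by
    calc D * x ≤ y / E * x := by
          gcongr
          exact hD.trans (by gcongr)
      _ = x * y / E := by ring
  have hyE : y ≤ x * y / E := by
    rw [le_div_iff₀ hE0, mul_comm x]
    gcongr
  calc q + (16 * D * x + y) * L' ≤ (16 * D * x + y + 1) * L' := by linarith
    _ ≤ (16 * D * x + y + 1) * (2 * L) := by gcongr
    _ ≤ 18 * (x * y / E) * (2 * L) := by
        gcongr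
        linarith
    _ = x * y / E * (36 * L) := by ring
    _ < x * y / E * F := by gcongr
    _ = 1 / F * (x * y) := by rw [hE]; field_simp

theorem rpow_three_halves_sub {a : ℝ} (ha : 0 < a) (ε : ℝ) :
    a ^ (3 / 2 - ε) = a * (√a / a ^ ε) := by
  rw [show 3 / 2 - ε = 1 + 1 / 2 - ε by ring, Real.rpow_sub ha, Real.rpow_add ha, Real.rpow_one,
    ← Real.sqrt_eq_rpow, mul_div_assoc]

theorem mul_sq_add_one_le_mul_self {w E D x : ℝ} (hE : 4112 ≤ E) (hEw : E ≤ w) (hD0 : 0 ≤ D)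
    (hD : D ≤ w / E) (hx : x ≤ 2 * E) : 8 * (x * (256 * D ^ 2 + 1)) ≤ w * w := by
  have hE0 : 0 < E := by linarith
  have hone : 1 ≤ (w / E) ^ 2 := one_le_pow₀ ((one_le_div hE0).mpr hEw)
  calc 8 * (x * (256 * D ^ 2 + 1)) ≤ 8 * (2 * E * (256 * (w / E) ^ 2 + (w / E) ^ 2)) := by gcongr
    _ = 4112 / E * (w * w) := by field_simp; ring
    _ ≤ w * w := mul_le_of_le_one_left (mul_self_nonneg w) ((div_le_one hE0).mpr hE)

theorem mul_add_two_le_mul_self {w E D y : ℝ} (hE : 96 ≤ E) (hEw : E ≤ w) (hD0 : 0 ≤ D)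
    (hD : D ≤ w / E) (hy : y ≤ 2 * w) : 8 * (y * (4 * D + 2)) ≤ w * w := by
  have hE0 : 0 < E := by linarith
  have hw0 : 0 < w := by linarith
  have hone : 1 ≤ w / E := (one_le_div hE0).mpr hEw
  calc 8 * (y * (4 * D + 2)) ≤ 8 * (2 * w * (4 * (w / E) + 2 * (w / E))) := by
        gcongr
        linarith
    _ = 96 / E * (w * w) := by ring
    _ ≤ w * w := mul_le_of_le_one_left (mul_self_nonneg w) ((div_le_one hE0).mpr hE)

theorem eventually_large_rpow {ε : ℝ} (hε : 0 < ε) (K : ℝ) :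
    ∀ᶠ n : ℕ in Filter.atTop, 9 ≤ n ∧ 1 ≤ Real.log n ∧ 36 * Real.log n < (n : ℝ) ^ (ε / 2) ∧
      K ≤ (n : ℝ) ^ ε := by
  have hlog := tendsto_natCast_atTop_atTop.eventually
    ((isLittleO_log_rpow_atTop (half_pos hε)).bound (show (0 : ℝ) < 1 / 37 by norm_num))
  have hrpow := ((tendsto_rpow_atTop hε).comp tendsto_natCast_atTop_atTop).eventually_ge_atTop K
  have hlog_ge := (Real.tendsto_log_atTop.comp tendsto_natCast_atTop_atTop).eventually_ge_atTop 1
  filter_upwards [hlog, hrpow, hlog_ge, Filter.eventually_ge_atTop 9] with n hlog hrpow hlog_ge hn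
  rw [Function.comp_apply] at hlog_ge hrpow
  rw [Real.norm_of_nonneg (by linarith), Real.norm_of_nonneg (by positivity)] at hlog
  exact ⟨hn, hlog_ge, by linarith, hrpow⟩

theorem sq_div_le_unavoidMax_of_large {ε : ℝ} {n e m Q : ℕ} (hε4 : ε ≤ 1 / 4) (hn : 9 ≤ n)
    (hL : 1 ≤ Real.log n) (hLF : 36 * Real.log n < (n : ℝ) ^ (ε / 2)) (hE : 5000 ≤ (n : ℝ) ^ ε)
    (he : e + m = n.choose 2) (hD : (m : ℝ) / n ≤ √n / (n : ℝ) ^ ε) (hQ : 2 ≤ Q) (hQn : Q ≤ n)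
    (hQ_ge : 64 * ((m : ℝ) / n) ≤ ε * Real.log n * Q) :
    (n : ℝ) ^ 2 / 18 / Q ≤ unavoidMax n e := by
  have hn9 : (9 : ℝ) ≤ n := by exact_mod_cast hn
  have hn0 : (0 : ℝ) < n := by linarith
  have hQ0 : (0 : ℝ) < Q := by exact_mod_cast (by omega : 0 < Q)
  have hw : 1 ≤ √(n : ℝ) := Real.one_le_sqrt.mpr (by linarith)
  have hEw : (n : ℝ) ^ ε ≤ √n := by
    rw [Real.sqrt_eq_rpow]
    exact Real.rpow_le_rpow_of_exponent_le (by linarith) (by linarith)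
  have hEF : (n : ℝ) ^ ε = (n : ℝ) ^ (ε / 2) * (n : ℝ) ^ (ε / 2) := by
    rw [← Real.rpow_add hn0, add_halves]
  have hlogQ : Real.log Q ≤ Real.log (n + 1) :=
    Real.log_le_log hQ0 (by exact_mod_cast hQn.trans n.le_succ)
  have hexp : 1 / (n : ℝ) ^ (ε / 2) ≤ Real.exp (-(32 * ((m : ℝ) / n) / Q)) := by
    rw [one_div, Real.rpow_def_of_pos hn0, ← Real.exp_neg, Real.exp_le_exp, neg_le_neg_iff,
      div_le_iff₀ hQ0]
    linarith
  have hwn := Real.mul_self_sqrt hn0.le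
  refine sq_div_le_unavoidMax (x := ⌈(n : ℝ) ^ ε⌉₊) (y := ⌈√(n : ℝ)⌉₊) he hn hQ
    ((mul_sq_add_one_le_mul_self (by linarith) hEw (by positivity) hD
      (Nat.ceil_le_two_mul (by linarith))).trans_eq hwn)
    ((mul_add_two_le_mul_self (by linarith) hEw (by positivity) hD
      (Nat.ceil_le_two_mul (by linarith))).trans_eq hwn) ?_
  refine (log_add_lt_div_mul (Real.rpow_pos_of_pos hn0 _) hEF hw (by linarith) hLF
    (log_add_one_le_two_mul_log (by linarith)) hlogQ (Nat.le_ceil _) (Nat.le_ceil _)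
    (by positivity) hD).trans_le ?_
  gcongr

theorem le_unavoidMax_of_large {ε : ℝ} {n e m : ℕ} (hε : 0 < ε) (hε4 : ε ≤ 1 / 4) (hn : 9 ≤ n)
    (hL : 1 ≤ Real.log n) (hLF : 36 * Real.log n < (n : ℝ) ^ (ε / 2))
    (hE : 5000 + 65 / ε ≤ (n : ℝ) ^ ε) (he : e + m = n.choose 2) (hm1 : n * Real.log n < (m : ℝ))
    (hm2 : (m : ℝ) < (n : ℝ) ^ (3 / 2 - ε)) :
    ε / 1170 * ((n : ℝ) ^ 3 * Real.log n / m) ≤ unavoidMax n e := by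
  have hn1 : (1 : ℝ) ≤ n := by exact_mod_cast (by omega : 1 ≤ n)
  have hn0 : (0 : ℝ) < n := by linarith
  have hm0 : (0 : ℝ) < m := hm1.trans' (by positivity)
  have hε65 : 0 < 65 / ε := by positivity
  have hD : (m : ℝ) / n ≤ √n / (n : ℝ) ^ ε := by
    rw [div_le_iff₀' hn0, ← rpow_three_halves_sub hn0]
    exact hm2.le
  set t : ℝ := (m : ℝ) / n / (ε * Real.log n) with ht
  have ht1 : 1 ≤ t := by
    rw [ht, one_le_div (by positivity), le_div_iff₀ hn0]
    nlinarith [mul_pos hn0 (by linarith : 0 < Real.log n)]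
  have htn : 65 * t ≤ n := by
    calc 65 * t ≤ 65 * ((m : ℝ) / n / (ε * 1)) := by rw [ht]; gcongr
      _ = 65 / ε * ((m : ℝ) / n) := by ring
      _ ≤ (n : ℝ) ^ ε * (√n / (n : ℝ) ^ ε) := by
          gcongr
          linarith
      _ = √n := by field_simp
      _ ≤ n := Real.sqrt_le_self_iff.mpr (.inr hn1)
  obtain ⟨Q, hQ_ge, hQ_le⟩ : ∃ Q : ℕ, 64 * t ≤ Q ∧ Q ≤ 65 * t :=
    ⟨⌈64 * t⌉₊, Nat.le_ceil _, by linarith [Nat.ceil_lt_add_one (by linarith : 0 ≤ 64 * t)]⟩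
  have hQ : 2 ≤ Q := by exact_mod_cast (by linarith : (2 : ℝ) ≤ Q)
  have hQ64 : 64 * ((m : ℝ) / n) ≤ ε * Real.log n * Q := by
    rwa [ht, mul_div_assoc', div_le_iff₀' (by positivity)] at hQ_ge
  calc ε / 1170 * ((n : ℝ) ^ 3 * Real.log n / m) = (n : ℝ) ^ 2 / 18 / (65 * t) := by
        rw [ht]
        field_simp
        norm_num
    _ ≤ (n : ℝ) ^ 2 / 18 / Q := by gcongr
    _ ≤ unavoidMax n e := sq_div_le_unavoidMax_of_large hε4 hn hL hLF (by linarith) he hD hQ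
        (by exact_mod_cast hQ_le.trans htn) hQ64

end DenseLowerBound

theorem two_le_of_mul_log_lt {n m : ℕ} (hm : m ≤ n.choose 2) (h : n * Real.log n < (m : ℝ)) :
    2 ≤ n := by
  have hm0 : 0 < m := Nat.cast_pos.mp
    (h.trans_le' (mul_nonneg n.cast_nonneg (Real.log_natCast_nonneg n)))
  by_contra hn
  have := Nat.choose_eq_zero_of_lt (not_le.mp hn)
  omega

theorem pow_three_mul_log_div_le_sq {n m : ℕ} (h : n * Real.log n < (m : ℝ)) :
    (n : ℝ) ^ 3 * Real.log n / m ≤ (n : ℝ) ^ 2 := by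
  refine div_le_of_le_mul₀ m.cast_nonneg (by positivity) ?_
  calc (n : ℝ) ^ 3 * Real.log n = (n : ℝ) ^ 2 * (n * Real.log n) := by ring
    _ ≤ (n : ℝ) ^ 2 * m := by gcongr

theorem one_le_unavoidMax {n e : ℕ} (he : e ≤ n.choose 2) (he1 : 1 ≤ e) : 1 ≤ unavoidMax n e := by
  refine (unavoidMax_isGreatest he).2 ⟨2, ⊤, fun G hG => ?_, ?_⟩
  · have hne : G ≠ ⊥ := by
      rintro rfl
      simp only [numEdges, edgeSet_bot, Set.ncard_empty] at hG
      omega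
    rw [Ne, ← cliqueFree_two, ← Fintype.card_fin 2, cliqueFree_iff_top_free] at hne
    exact not_not.mp hne
  · rw [numEdges_eq_card, card_edgeFinset_top_eq_card_choose_two, Fintype.card_fin,
      Nat.choose_self]

theorem exists_le_unavoidMax_dense {ε : ℝ} (hε : 0 < ε) :
    ∃ c : ℝ, 0 < c ∧ ∀ n e m : ℕ, e + m = n.choose 2 → 1 ≤ e →
      n * Real.log n < (m : ℝ) → (m : ℝ) < (n : ℝ) ^ (3 / 2 - ε) →
        c * ((n : ℝ) ^ 3 * Real.log n / m) ≤ unavoidMax n e := by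
  obtain ⟨δ, hδ, hδε, hδ4⟩ : ∃ δ : ℝ, 0 < δ ∧ δ ≤ ε ∧ δ ≤ 1 / 4 :=
    ⟨min ε (1 / 4), by positivity, min_le_left _ _, min_le_right _ _⟩
  obtain ⟨n₀, hlarge⟩ :=
    Filter.eventually_atTop.mp (eventually_large_rpow hδ (5000 + 65 / δ))
  refine ⟨min (δ / 1170) (1 / ((n₀ : ℝ) ^ 2 + 1)), by positivity,
    fun n e m he he1 hm1 hm2 => ?_⟩
  rcases lt_or_ge n n₀ with hn | hn
  · calc min (δ / 1170) (1 / ((n₀ : ℝ) ^ 2 + 1)) * ((n : ℝ) ^ 3 * Real.log n / m)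
        ≤ 1 / ((n₀ : ℝ) ^ 2 + 1) * (n : ℝ) ^ 2 := by
          gcongr
          · exact min_le_right _ _
          · exact pow_three_mul_log_div_le_sq hm1
      _ ≤ 1 / ((n₀ : ℝ) ^ 2 + 1) * ((n₀ : ℝ) ^ 2 + 1) := by
          gcongr
          exact_mod_cast (Nat.pow_le_pow_left hn.le 2).trans (Nat.le_succ _)
      _ = 1 := by field_simp
      _ ≤ unavoidMax n e := by exact_mod_cast one_le_unavoidMax (by omega) he1
  · obtain ⟨hn9, hL, hLF, hE⟩ := hlarge n hn
    refine (mul_le_mul_of_nonneg_right (min_le_left _ _) (by positivity)).trans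
      (le_unavoidMax_of_large hδ hδ4 hn9 hL hLF hE he hm1 (hm2.trans_le ?_))
    exact Real.rpow_le_rpow_of_exponent_le (by exact_mod_cast (by omega : 1 ≤ n)) (by linarith)

theorem mul_sub_le_mul_log_of_pow_le {N U B : ℝ} {m : ℕ} (hN : 0 < N) (hU : 0 ≤ U) (hB : 0 < B)
    (h : N ^ m ≤ B * U ^ m) : m * (N - U) ≤ N * Real.log B := by
  have hU_le : U ≤ N * Real.exp (-((N - U) / N)) := by
    calc U = N * (1 - (N - U) / N) := by field_simp; ring
      _ ≤ N * Real.exp (-((N - U) / N)) := by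
          gcongr
          exact Real.one_sub_le_exp_neg _
  have hexp : Real.exp (m * ((N - U) / N)) ≤ B := by
    have : N ^ m ≤ N ^ m * (B * Real.exp (-(m * ((N - U) / N)))) := by
      calc N ^ m ≤ B * (N * Real.exp (-((N - U) / N))) ^ m := h.trans (by gcongr)
        _ = N ^ m * (B * Real.exp (-((N - U) / N)) ^ m) := by ring
        _ = N ^ m * (B * Real.exp (-(m * ((N - U) / N)))) := by
            rw [← Real.exp_nat_mul, mul_neg]
    rwa [le_mul_iff_one_le_right (by positivity), Real.exp_neg, ← div_eq_mul_inv,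
      one_le_div (Real.exp_pos _)] at this
  calc m * (N - U) = N * (m * ((N - U) / N)) := by field_simp
    _ ≤ N * Real.log B := by
        gcongr
        rwa [Real.le_log_iff_exp_le hB]

theorem unavoidMax_le {n e m : ℕ} (he : e + m = n.choose 2) (hm : n * Real.log n < (m : ℝ)) :
    (unavoidMax n e : ℝ) ≤ (n : ℝ) ^ 3 * Real.log n / m := by
  have hn2 : 2 ≤ n := two_le_of_mul_log_lt (by omega) hm
  have hm0 : (0 : ℝ) < m :=
    hm.trans_le' (mul_nonneg n.cast_nonneg (Real.log_natCast_nonneg n))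
  obtain ⟨U, hU, hUe⟩ := (univMin_isLeast n m).1
  have hdual : (unavoidMax n e : ℝ) = (n.choose 2 : ℕ) - numEdges U := by
    rw [hUe, ← univMin_add_unavoidMax he, Nat.cast_add, add_sub_cancel_left]
  have hcount : ((n.choose 2 : ℕ) : ℝ) ^ m ≤ ((n : ℝ) + 1) ^ n * (numEdges U : ℝ) ^ m := by
    have hsupport : U.support.ncard ≤ n := by
      simpa using Set.ncard_le_card U.support
    have hedges : numEdges U ≤ n.choose 2 := by
      simpa using numEdges_le_choose U
    exact_mod_cast (choose_two_pow_le le_rfl (by omega) hU hedges).trans (by gcongr)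
  have hmul := mul_sub_le_mul_log_of_pow_le (by exact_mod_cast Nat.choose_pos hn2)
    (Nat.cast_nonneg _) (by positivity) hcount
  rw [← hdual, Real.log_pow] at hmul
  rw [le_div_iff₀' hm0]
  calc m * (unavoidMax n e : ℝ) ≤ (n.choose 2 : ℕ) * (n * Real.log (n + 1)) := hmul
    _ ≤ ((n : ℝ) ^ 2 / 2) * (n * (2 * Real.log n)) := by
        gcongr
        · exact mul_nonneg n.cast_nonneg (Real.log_nonneg (by simp))
        · exact_mod_cast Nat.choose_le_pow_div (α := ℝ) 2 n
        · exact log_add_one_le_two_mul_log (Nat.ofNat_le_cast.mpr hn2)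
    _ = (n : ℝ) ^ 3 * Real.log n := by ring

theorem theorem1 :
    -- unavoidable graphs, first range
    (∃ c C : ℝ, 0 < c ∧ 0 < C ∧ ∀ n e m : ℕ, e + m = n.choose 2 → 2 ≤ m →
      (m : ℝ) ≤ n * Real.log n →
        c * ((m : ℝ) ^ 2 / Real.log m ^ 2) ≤ (n.choose 2 : ℝ) - unavoidMax n e ∧
        (n.choose 2 : ℝ) - unavoidMax n e ≤ C * ((m : ℝ) ^ 2 / Real.log m ^ 2)) ∧
    -- unavoidable graphs, second range
    (∀ ε : ℝ, 0 < ε → ∃ c C : ℝ, 0 < c ∧ 0 < C ∧ ∀ n e m : ℕ, e + m = n.choose 2 → 1 ≤ e →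
      n * Real.log n < (m : ℝ) → (m : ℝ) < (n : ℝ) ^ (3 / 2 - ε) →
        c * ((n : ℝ) ^ 3 * Real.log n / m) ≤ unavoidMax n e ∧
        (unavoidMax n e : ℝ) ≤ C * ((n : ℝ) ^ 3 * Real.log n / m)) ∧
    -- universal graphs, first range
    (∃ c C : ℝ, 0 < c ∧ 0 < C ∧ ∀ n m : ℕ, m ≤ n.choose 2 → 2 ≤ m →
      (m : ℝ) ≤ n * Real.log n →
        c * ((m : ℝ) ^ 2 / Real.log m ^ 2) ≤ univMin n m ∧
        (univMin n m : ℝ) ≤ C * ((m : ℝ) ^ 2 / Real.log m ^ 2)) ∧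
    -- universal graphs, second range
    (∀ ε : ℝ, 0 < ε → ∃ c C : ℝ, 0 < c ∧ 0 < C ∧ ∀ n m : ℕ, m < n.choose 2 →
      n * Real.log n < (m : ℝ) → (m : ℝ) < (n : ℝ) ^ (3 / 2 - ε) →
        c * ((n : ℝ) ^ 3 * Real.log n / m) ≤ (n.choose 2 : ℝ) - univMin n m ∧
        (n.choose 2 : ℝ) - univMin n m ≤ C * ((n : ℝ) ^ 3 * Real.log n / m)) := by
  have hdual {n e m : ℕ} (he : e + m = n.choose 2) :
      ((n.choose 2 : ℕ) : ℝ) = univMin n m + unavoidMax n e := by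
    exact_mod_cast (univMin_add_unavoidMax he).symm
  obtain ⟨C, hC, hupper⟩ := exists_univMin_le_sparse
  refine ⟨⟨1 / 81, C, by norm_num, hC, fun n e m he hm hmn => ?_⟩, fun ε hε => ?_,
    ⟨1 / 81, C, by norm_num, hC, fun n m hm hm2 hmn =>
      ⟨sq_div_log_le_univMin hm hm2 hmn, hupper n m hm2⟩⟩, fun ε hε => ?_⟩
  · rw [hdual he, add_sub_cancel_right]
    exact ⟨sq_div_log_le_univMin (by omega) hm hmn, hupper n m hm⟩
  · obtain ⟨c, hc, hlower⟩ := exists_le_unavoidMax_dense hε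
    refine ⟨c, 1, hc, one_pos, fun n e m he he1 hm1 hm2 => ?_⟩
    rw [one_mul]
    exact ⟨hlower n e m he he1 hm1 hm2, unavoidMax_le he hm1⟩
  · obtain ⟨c, hc, hlower⟩ := exists_le_unavoidMax_dense hε
    refine ⟨c, 1, hc, one_pos, fun n m hm hm1 hm2 => ?_⟩
    have he : n.choose 2 - m + m = n.choose 2 := Nat.sub_add_cancel hm.le
    rw [hdual he, add_sub_cancel_left, one_mul]
    exact ⟨hlower n _ m he (by omega) hm1 hm2, unavoidMax_le he hm1⟩
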